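/- **Setting.** Let $\mathcal Z=\{z_1,\dots,z_K\}\subset\mathbb R^d$, $K\ge 1$, be a finite set of arms that spans $\mathbb R^d$, with $\|z\|\le 1$ for all $z\in\mathcal Z$, and let $\theta^*\in\mathbb R^d$ satisfy $z^\top\theta^*\neq 0$ for all $z\in\mathcal Z$. Let $\mu(x)=1/(1+e^{-x})$. Each query of an arm $z$ returns a label $y\in\{0,1\}$ with $\mathbb P(y=1)=\mu(z^\top\theta^*)$; the labels of different queries are independent. Let $\delta>0$, $\omega>0$, and let $\kappa_0$ satisfy $0<\kappa_0\le\min_{z\in\mathcal Z}\dot\mu(z^\top\theta^*)$. **Notation.** $\Delta(\mathcal Z)$ is the set of probability vectors on $\mathcal Z$; $A(\lambda)=\sum_{z}\lambda_z zz^\top$; $H(\lambda,\theta)=\sum_{z}\lambda_z\dot\mu(z^\top\theta)zz^\top$; $\|x\|_{M^{-1}}^2=x^\top M^{-1}x$, and a design $\lambda$ whose matrix $M$ is singular counts as having objective $+\infty$. Let $\gamma=64\bigl(d\log 6+\log\frac{2+K}{\delta}\bigr)$, $\varepsilon_\ell=2^{-\ell+1}$ and $r(\omega)=(d(d+1)+2)/\omega$.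 An "optimal design" is a minimizer over $\Delta(\mathcal Z)$ of the stated objective with at most $d(d+1)/2+1$ support points. $\mathrm{ROUND}(\lambda,n)$ is efficient rounding: a multiset of $n$ arms in which each $z$ with $\lambda_z>0$ occurs $n_z$ times, other arms do not occur, $\sum_z n_z=n$, and for some $\nu\ge 0$ one has $\nu\lambda_z\le n_z\le\nu\lambda_z+1$ whenever $\lambda_z>0$. The MLE for a multiset of queried arms $z_s$ with labels $y_s$ is a maximizer over $\theta\in\mathbb R^d$ of $\sum_s y_s\log\mu(z_s^\top\theta)+(1-y_s)\log(1-\mu(z_s^\top\theta))$. Non-unique minimizers, roundings and maximizers are chosen by arbitrary fixed deterministic rules. **Algorithm.** 1. Warm-up: let $\lambda_0$ be an optimal design for $\max_{z\in\mathcal Z}\|z\|^2_{A(\lambda)^{-1}}$ and $N_0=\bigl\lceil 3(1+\omega)\kappa_0^{-1}d\,\gamma\log\frac{2K(2+K)}{\delta}\bigr\rceil$. Query the arms of $\mathrm{ROUND}(\lambda_0,N_0)$ and let $\hat\theta_0$ be the MLE for these data. Set $\mathcal Z_1=\mathcal Z$, $Q=\emptyset$, $\ell=1$. 2. While $\mathcal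 Z_\ell\ne\emptyset$: let $\lambda_\ell$ be an optimal design for $$f_\ell(\lambda)=\max\Bigl\{\gamma\max_{z\in\mathcal Z}\|z\|^2_{H(\lambda,\hat\theta_{\ell-1})^{-1}},\ 2.4^2\varepsilon_\ell^{-2}\max_{z\in\mathcal Z_\ell}\|z\|^2_{H(\lambda,\hat\theta_{\ell-1})^{-1}}\Bigr\},$$ $N_\ell=\max\bigl\{\bigl\lceil 3(1+\omega)f_\ell(\lambda_\ell)\log\frac{2\ell^2K(2+K)}{\delta}\bigr\rceil,\lceil r(\omega)\rceil\bigr\}$ and $Z_\ell=\mathrm{ROUND}(\lambda_\ell,N_\ell)$. Add $Z_\ell$ to the multiset $Q$, query the arms of $Z_\ell$, let $\hat\theta_\ell$ be the MLE for the data of this round only, set $\mathcal Z_{\ell+1}=\{z\in\mathcal Z_\ell:|z^\top\hat\theta_\ell|\le\varepsilon_\ell\}$ and increase $\ell$ by one. 3. Replay: query all arms of $Q$ (with multiplicity) once more, obtaining fresh labels, and return the MLE $\hat\theta$ for these new data. **Theorem.** With probability at least $1-\delta$, all maximum likelihood estimates computed by the algorithm exist, the algorithm halts after finitely many rounds, and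 its output $\hat\theta$ classifies every arm correctly: $$\operatorname{sign}(z^\top\hat\theta)=\operatorname{sign}(z^\top\theta^*)\quad\text{for all }z\in\mathcal Z.$$ -/

import Mathlib

noncomputable section

namespace ActivePref

/-- Feature vectors and parameters live in `ℝ^d` with the Euclidean norm. -/
abbrev E (d : ℕ) : Type := EuclideanSpace ℝ (Fin d)

/-- Derivative of the logistic link. -/
def dlink (x : ℝ) : ℝ := deriv Real.sigmoid x

section Design

variable {d : ℕ} {ι : Type*} [Fintype ι]

/-- `∑ᵢ wᵢ zᵢ zᵢᵀ`. -/
def infoMatrix (z : ι → E d) (w : ι → ℝ) : Matrix (Fin d) (Fin d) ℝ :=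
  ∑ i, w i • Matrix.vecMulVec (⇑(z i)) (⇑(z i))

/-- `H(lam, θ) = ∑ᵢ lamᵢ μ'(zᵢᵀθ) zᵢ zᵢᵀ`. -/
def fisher (z : ι → E d) (lam : ι → ℝ) (θ : E d) : Matrix (Fin d) (Fin d) ℝ :=
  infoMatrix z (fun i => lam i * dlink (inner ℝ (z i) θ))

/-- `‖x‖²` in the norm of `M⁻¹`; only used for positive definite `M`. -/
def invNormSq (M : Matrix (Fin d) (Fin d) ℝ) (x : E d) : ℝ :=
  ⇑x ⬝ᵥ (M⁻¹.mulVec ⇑x)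

/-- `lam` minimizes `F` over the probability vectors whose matrix `M lam` is nonsingular (a
singular matrix counts as infinite objective), and its support has at most `d (d + 1) / 2 + 1`
points, which is the sparsity that makes the rounding threshold `r(ω)` meaningful. -/
def IsOptimalDesign (M : (ι → ℝ) → Matrix (Fin d) (Fin d) ℝ) (F : (ι → ℝ) → ℝ)
    (lam : ι → ℝ) : Prop :=
  (lam ∈ stdSimplex ℝ ι ∧ (M lam).PosDef) ∧
  (∀ lam' ∈ stdSimplex ℝ ι, (M lam').PosDef → F lam ≤ F lam') ∧
  (Function.support lam).ncard ≤ d * (d + 1) / 2 + 1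

/-- The G-optimality objective `max_z ‖z‖²` in the norm of `(∑ lam_z z zᵀ)⁻¹`. -/
def gObjective (z : ι → E d) (lam : ι → ℝ) : ℝ :=
  ⨆ i, invNormSq (infoMatrix z lam) (z i)

/-- `γ(d) = 64 (d log 6 + log((2 + |Z|)/δ))`. -/
def gam (ι : Type*) [Fintype ι] (d : ℕ) (δ : ℝ) : ℝ :=
  64 * (d * Real.log 6 + Real.log ((2 + Fintype.card ι) / δ))

/-- `ε_ℓ = 2^(-ℓ+1)`. -/
def eps (l : ℕ) : ℝ := (2 : ℝ) ^ (1 - (l : ℤ))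

/-- The objective `f = f₁ ∨ f₂` of round `l` with active arms `A` and previous estimate `θ`. -/
def objective (z : ι → E d) (δ : ℝ) (l : ℕ) (A : Finset ι) (θ : E d) (lam : ι → ℝ) : ℝ :=
  max (gam ι d δ * ⨆ i, invNormSq (fisher z lam θ) (z i))
    (2.4 ^ 2 * (eps l ^ 2)⁻¹ * ⨆ i : {i // i ∈ A}, invNormSq (fisher z lam θ) (z i))

/-- Efficient rounding of a design `lam` to `n` pulls: for some multiplier `ν`, every support point
receives `ν lamᵢ` rounded up (an integer `ν lamᵢ` may be kept or raised by one), and the numbers of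
pulls add up to `n`. -/
def IsRounding (lam : ι → ℝ) (n : ℕ) (c : ι → ℕ) : Prop :=
  ∑ i, c i = n ∧ (∀ i, lam i = 0 → c i = 0) ∧
  ∃ ν : ℝ, 0 ≤ ν ∧ ∀ i, lam i ≠ 0 → ν * lam i ≤ c i ∧ (c i : ℝ) ≤ ν * lam i + 1

/-- Logistic log-likelihood of the data in which arm `i` is pulled `c i` times, with labels
`y i 0, …, y i (c i - 1)` (`true` is the label `1`). -/
def logLik (z : ι → E d) (c : ι → ℕ) (y : (i : ι) → Fin (c i) → Bool) (θ : E d) : ℝ :=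
  ∑ i, ∑ j, if y i j then Real.log (Real.sigmoid (inner ℝ (z i) θ))
    else Real.log (1 - Real.sigmoid (inner ℝ (z i) θ))

/-- `θ` is a maximum likelihood estimate. -/
def IsMLE (z : ι → E d) (c : ι → ℕ) (y : (i : ι) → Fin (c i) → Bool) (θ : E d) : Prop :=
  ∀ θ', logLik z c y θ' ≤ logLik z c y θ

/-- The deterministic subroutines of the algorithm. Minimizers, roundings and maximizers need not be
unique, so any fixed way of choosing them is allowed. Each subroutine returns a solution whenever
there is one; nothing is said about its value otherwise. -/
structure Solver (z : ι → E d) (δ : ℝ) where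
  warmDesign : ι → ℝ
  design : ℕ → Finset ι → E d → ι → ℝ
  round : (ι → ℝ) → ℕ → ι → ℕ
  mle : (c : ι → ℕ) → ((i : ι) → Fin (c i) → Bool) → E d
  warmDesign_spec : (∃ lam, IsOptimalDesign (infoMatrix z) (gObjective z) lam) →
    IsOptimalDesign (infoMatrix z) (gObjective z) warmDesign
  design_spec : ∀ l A θ,
    (∃ lam, IsOptimalDesign (fun w => fisher z w θ) (objective z δ l A θ) lam) →
    IsOptimalDesign (fun w => fisher z w θ) (objective z δ l A θ) (design l A θ)
  round_spec : ∀ lam n, (∃ c, IsRounding lam n c) → IsRounding lam n (round lam n)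
  mle_spec : ∀ c y, (∃ θ, IsMLE z c y θ) → IsMLE z c y (mle c y)

end Design

/-- The three kinds of batches of label queries. -/
inductive Phase where
  | warmup : Phase
  | main (l : ℕ) : Phase
  | replay : Phase

/-- What the algorithm carries from round to round. -/
structure State (d : ℕ) (ι : Type*) where
  /-- the latest estimate -/
  est : E d
  /-- the active arms -/
  active : Finset ι
  /-- how often each arm occurs in the collection `Q` of arms queried in the main rounds -/
  pulled : ι → ℕ

section Algorithm

variable {d : ℕ} {ι : Type*} [Fintype ι] {z : ι → E d} {δ : ℝ}

/-- `r(ω) = (d (d + 1) + 2) / ω`. -/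
def rThreshold (d : ℕ) (ω : ℝ) : ℝ := (d * (d + 1) + 2) / ω

/-- Number of warm-up queries. -/
def warmN (ι : Type*) [Fintype ι] (d : ℕ) (δ ω κ₀ : ℝ) : ℕ :=
  ⌈3 * (1 + ω) * κ₀⁻¹ * d * gam ι d δ *
    Real.log (2 * Fintype.card ι * (2 + Fintype.card ι) / δ)⌉₊

/-- Numbers of pulls of the arms in the warm-up. -/
def warmCounts (S : Solver z δ) (ω κ₀ : ℝ) : ι → ℕ :=
  S.round S.warmDesign (warmN ι d δ ω κ₀)

/-- Number `N_ℓ` of queries in round `l`, started from `s`. -/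
def roundN (S : Solver z δ) (ω : ℝ) (l : ℕ) (s : State d ι) : ℕ :=
  max ⌈3 * (1 + ω) * objective z δ l s.active s.est (S.design l s.active s.est) *
      Real.log (2 * (l : ℝ) ^ 2 * Fintype.card ι * (2 + Fintype.card ι) / δ)⌉₊
    ⌈rThreshold d ω⌉₊

/-- Numbers of pulls of the arms in round `l`, started from `s`. -/
def roundCounts (S : Solver z δ) (ω : ℝ) (l : ℕ) (s : State d ι) : ι → ℕ :=
  S.round (S.design l s.active s.est) (roundN S ω l s)

/-- The labels of a batch with `c i` pulls of arm `i`, read from the table `y`: `y p i j` is the label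
shown at the `j`-th query of arm `i` in batch `p`. -/
def labels (y : Phase → ι → ℕ → Bool) (p : Phase) (c : ι → ℕ) : (i : ι) → Fin (c i) → Bool :=
  fun i j => y p i j

open Classical in
/-- The state after `k` rounds when the labels are those of the table `y`. -/
def state (S : Solver z δ) (ω κ₀ : ℝ) (y : Phase → ι → ℕ → Bool) : ℕ → State d ι
  | 0 => ⟨S.mle (warmCounts S ω κ₀) (labels y .warmup (warmCounts S ω κ₀)), Finset.univ, 0⟩
  | k + 1 =>
    let s := state S ω κ₀ y k
    let c := roundCounts S ω (k + 1) s
    let θ := S.mle c (labels y (.main (k + 1)) c)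
    ⟨θ, s.active.filter (fun i => ¬ eps (k + 1) < |inner ℝ (z i) θ|), s.pulled + c⟩

/-- The loop ends after exactly `T` rounds. -/
def HaltsAt (S : Solver z δ) (ω κ₀ : ℝ) (y : Phase → ι → ℕ → Bool) (T : ℕ) : Prop :=
  (state S ω κ₀ y T).active = ∅ ∧ ∀ k < T, (state S ω κ₀ y k).active ≠ ∅

/-- The estimate returned when the loop ends after `T` rounds: the refit on new labels for all arms
in `Q`. -/
def output (S : Solver z δ) (ω κ₀ : ℝ) (y : Phase → ι → ℕ → Bool) (T : ℕ) : E d :=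
  S.mle (state S ω κ₀ y T).pulled (labels y .replay (state S ω κ₀ y T).pulled)

/-- Every estimate computed in a run of `T` rounds, including the returned one, is a genuine maximum
likelihood estimate for its data. -/
def EstimatesExist (S : Solver z δ) (ω κ₀ : ℝ) (y : Phase → ι → ℕ → Bool) (T : ℕ) : Prop :=
  IsMLE z (warmCounts S ω κ₀) (labels y .warmup (warmCounts S ω κ₀)) (state S ω κ₀ y 0).est ∧
  (∀ k < T, IsMLE z (roundCounts S ω (k + 1) (state S ω κ₀ y k))
    (labels y (.main (k + 1)) (roundCounts S ω (k + 1) (state S ω κ₀ y k)))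
    (state S ω κ₀ y (k + 1)).est) ∧
  IsMLE z (state S ω κ₀ y T).pulled (labels y .replay (state S ω κ₀ y T).pulled)
    (output S ω κ₀ y T)

end Algorithm

end ActivePref

end

noncomputable section

namespace ActivePref

/-! ### The logistic link -/

/-! Fix a batch with counts c. Put M = Σ c_i μ'(z_iᵀθ*) z_i z_iᵀ and let s be the sum of the centred
labels times their arms. To first order the MLE errs by M⁻¹s, so its error at arm k is L_k =
z_kᵀM⁻¹s (`linError`), a sum of independent centred terms with variance ‖z_k‖² in the M⁻¹-norm. A
Chernoff bound and a union over the K arms give |L_k| ≤ b‖z_k‖ for all k, with b² = 2.75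
log(2ℓ²K(2+K)/δ) (`linError_tail`).

These K scalar bounds control the whole vector, with no net of the sphere: s = Σ c_k μ'_k L_k z_k,
so Cauchy-Schwarz and Σ c_k μ'_k ‖z_k‖² = d give s dual norm at most √d b
(`RegularBatch.abs_score_sum_le`). If also √d b‖z_i‖ ≤ 0.1 for all arms, self-concordance confines
every parameter at least as likely as θ* to a small neighbourhood. Hence an MLE exists, and
expanding its first-order condition around θ* bounds its error at arm k by 1.07 b‖z_k‖, without the
factor √d (`RegularBatch.abs_inner_sub_le`).

The first term of f_ℓ provides this leverage condition. Each estimate is then within 0.107 at all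
arms, so H(λ, θ̂) is comparable to H(λ, θ*) when the next design is chosen. The warm-up starts this
induction by the Kiefer-Wolfowitz bound and κ₀. The second term gives error at most 0.49 ε_ℓ at
active arms. So arms with |zᵀθ*| > 1.49 ε_ℓ do not survive round ℓ, and an arm eliminated there has
|zᵀθ*| > 0.51 ε_ℓ. The replay is at least as informative as that round, errs there by at most 0.49
ε_ℓ, and gets the sign right (`correct_of_no_badBatch`).

The counts of a batch depend only on labels of other phases, so the bound for fixed counts survives
their randomness (`measure_mem_random_le`). The failure probabilities 2δ/9 (warm-up), 2δ/(9ℓ²)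
(round ℓ) and 2δ/9 (replay) sum to less than δ. -/

lemma dlink_eq (x : ℝ) : dlink x = Real.sigmoid x * (1 - Real.sigmoid x) := by
  simp [dlink, Real.deriv_sigmoid]

lemma dlink_pos (x : ℝ) : 0 < dlink x := by
  rw [dlink_eq]
  exact mul_pos (Real.sigmoid_pos x) (sub_pos.2 (Real.sigmoid_lt_one x))

lemma dlink_le_one (x : ℝ) : dlink x ≤ 1 := by
  rw [dlink_eq]
  nlinarith [Real.sigmoid_pos x, Real.sigmoid_lt_one x]

lemma dlink_neg (x : ℝ) : dlink (-x) = dlink x := by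
  rw [dlink_eq, dlink_eq, Real.sigmoid_neg]; ring

/-- For a ≥ 0 the factor 1 + μ(x)(e^a - 1) lies between 1 and e^a; these two extremes give the lower
and upper increment bounds that follow. -/
lemma sigmoid_add_sub (x a : ℝ) :
    (Real.sigmoid (x + a) - Real.sigmoid x) * (1 + Real.sigmoid x * (Real.exp a - 1)) =
      dlink x * (Real.exp a - 1) := by
  rw [dlink_eq, Real.sigmoid_def, Real.sigmoid_def, neg_add, Real.exp_add, Real.exp_neg a]
  have h1 := Real.exp_pos (-x)
  have h2 := Real.exp_pos a
  field_simp
  ring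

lemma sigmoid_increment_lower {a : ℝ} (ha : 0 ≤ a) (x : ℝ) :
    dlink x * (1 - Real.exp (-a)) ≤ Real.sigmoid (x + a) - Real.sigmoid x := by
  have h := sigmoid_add_sub x a
  have h0 := Real.sigmoid_pos x
  have h1 := Real.sigmoid_lt_one x
  have he : 1 ≤ Real.exp a := Real.one_le_exp ha
  have hm : 0 ≤ Real.sigmoid (x + a) - Real.sigmoid x :=
    sub_nonneg.2 (Real.sigmoid_le (by linarith))
  have h2 : dlink x * (Real.exp a - 1) ≤
      (Real.sigmoid (x + a) - Real.sigmoid x) * Real.exp a := by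
    rw [← h]
    exact mul_le_mul_of_nonneg_left (by nlinarith) hm
  have h3 : Real.exp (-a) * Real.exp a = 1 := by rw [← Real.exp_add]; simp
  have h4 : dlink x * (1 - Real.exp (-a)) * Real.exp a ≤
      (Real.sigmoid (x + a) - Real.sigmoid x) * Real.exp a := by
    calc _ = dlink x * (Real.exp a - Real.exp (-a) * Real.exp a) := by ring
      _ ≤ _ := by rw [h3]; exact h2
  exact le_of_mul_le_mul_right h4 (Real.exp_pos a)

lemma sigmoid_increment_upper {a : ℝ} (ha : 0 ≤ a) (x : ℝ) :
    Real.sigmoid (x + a) - Real.sigmoid x ≤ dlink x * (Real.exp a - 1) := by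
  have h := sigmoid_add_sub x a
  have h0 := Real.sigmoid_pos x
  have he : 1 ≤ Real.exp a := Real.one_le_exp ha
  have hm : 0 ≤ Real.sigmoid (x + a) - Real.sigmoid x :=
    sub_nonneg.2 (Real.sigmoid_le (by linarith))
  rw [← h]
  nlinarith [mul_nonneg hm (mul_nonneg h0.le (sub_nonneg.2 he))]

lemma sigmoid_add_sub_neg (x a : ℝ) :
    Real.sigmoid (-x + -a) - Real.sigmoid (-x) = -(Real.sigmoid (x + a) - Real.sigmoid x) := by
  rw [← neg_add, Real.sigmoid_neg, Real.sigmoid_neg]; ring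

/-- Strong monotonicity of the logistic link. -/
lemma sigmoid_increment_mul_lower (x a : ℝ) :
    dlink x * (|a| * (1 - Real.exp (-|a|))) ≤ (Real.sigmoid (x + a) - Real.sigmoid x) * a := by
  rcases le_total 0 a with ha | ha
  · rw [abs_of_nonneg ha]
    nlinarith [mul_le_mul_of_nonneg_right (sigmoid_increment_lower ha x) ha]
  · rw [abs_of_nonpos ha]
    have h := sigmoid_increment_lower (neg_nonneg.2 ha) (-x)
    rw [sigmoid_add_sub_neg, dlink_neg] at h
    nlinarith [mul_le_mul_of_nonneg_right h (neg_nonneg.2 ha)]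

/-- A rewriting of a ≤ sinh a. It lets a single expression bound the linearization error from both
sides. -/
lemma sub_one_add_exp_neg_le {a : ℝ} (ha : 0 ≤ a) :
    a - 1 + Real.exp (-a) ≤ Real.exp a - 1 - a := by
  have := Real.self_le_sinh_iff.2 ha
  rw [Real.sinh_eq] at this
  linarith

/-- Second-order control of the logistic link. -/
lemma abs_sigmoid_increment_sub (x a : ℝ) :
    |dlink x * a - (Real.sigmoid (x + a) - Real.sigmoid x)| ≤
      dlink x * (Real.exp |a| - 1 - |a|) := by
  have key : ∀ {a : ℝ} (x : ℝ), 0 ≤ a →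
      |dlink x * a - (Real.sigmoid (x + a) - Real.sigmoid x)| ≤
        dlink x * (Real.exp a - 1 - a) := by
    intro a x ha
    rw [abs_le]
    constructor
    · linarith [sigmoid_increment_upper ha x]
    · have h1 := sigmoid_increment_lower ha x
      have h2 := mul_le_mul_of_nonneg_left (sub_one_add_exp_neg_le ha) (dlink_pos x).le
      linarith
  rcases le_total 0 a with ha | ha
  · rw [abs_of_nonneg ha]; exact key x ha
  · rw [abs_of_nonpos ha]
    have h := key (-x) (neg_nonneg.2 ha)
    rw [sigmoid_add_sub_neg, dlink_neg] at h
    rw [← abs_neg]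
    convert h using 2
    ring

/-- Self-concordance: the logarithmic derivative 1 - 2μ of μ' lies in [-1, 1]. For a ≥ 0 the two
factors of μ(1 - μ) are compared separately. This is what allows θ* to replace an estimate inside
the information matrix. -/
lemma dlink_le_exp_mul (x a : ℝ) : dlink x ≤ Real.exp |a| * dlink (x + a) := by
  have key : ∀ {a : ℝ} (x : ℝ), 0 ≤ a → dlink x ≤ Real.exp a * dlink (x + a) := by
    intro a x ha
    have h0 := Real.sigmoid_pos x
    have h1 := Real.sigmoid_le (show x ≤ x + a by linarith)
    have h2 := sub_pos.2 (Real.sigmoid_lt_one (x + a))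
    have h3 : 1 - Real.sigmoid x ≤ Real.exp a * (1 - Real.sigmoid (x + a)) := by
      rw [← Real.sigmoid_neg, ← Real.sigmoid_neg, Real.sigmoid_def, Real.sigmoid_def, neg_neg,
        neg_neg, Real.exp_add, ← div_eq_mul_inv, inv_eq_one_div,
        div_le_div_iff₀ (by positivity) (by positivity)]
      nlinarith [Real.one_le_exp ha, Real.exp_pos x]
    rw [dlink_eq, dlink_eq]
    calc Real.sigmoid x * (1 - Real.sigmoid x)
        ≤ Real.sigmoid (x + a) * (Real.exp a * (1 - Real.sigmoid (x + a))) :=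
          mul_le_mul h1 h3 (sub_nonneg.2 (Real.sigmoid_lt_one x).le) (Real.sigmoid_pos _).le
      _ = _ := by ring
  rcases le_total 0 a with ha | ha
  · rw [abs_of_nonneg ha]; exact key x ha
  · rw [abs_of_nonpos ha]
    have h := key (-x) (neg_nonneg.2 ha)
    rwa [← neg_add, dlink_neg, dlink_neg] at h

/-- The log-partition function of the logistic model. -/
def softplus (x : ℝ) : ℝ := Real.log (1 + Real.exp x)

lemma log_sigmoid (x : ℝ) : Real.log (Real.sigmoid x) = x - softplus x := by
  have h := Real.exp_pos x
  have : Real.sigmoid x = Real.exp x / (1 + Real.exp x) := by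
    rw [Real.sigmoid_def, Real.exp_neg]; field_simp; ring
  rw [this, Real.log_div (by positivity) (by positivity), Real.log_exp, softplus]

lemma log_one_sub_sigmoid (x : ℝ) : Real.log (1 - Real.sigmoid x) = -softplus x := by
  rw [← Real.sigmoid_neg, Real.sigmoid_def, neg_neg, Real.log_inv, softplus]

lemma hasDerivAt_softplus (x : ℝ) : HasDerivAt softplus (Real.sigmoid x) x := by
  have h := ((Real.hasDerivAt_exp x).const_add 1).log (by positivity)
  refine h.congr_deriv ?_
  rw [Real.sigmoid_def, Real.exp_neg]
  have := Real.exp_pos x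
  field_simp
  ring

/-- Multiplied by 2 + t, the claim is e^(-t)(2 + t) - 2 + t ≥ 0, which vanishes at 0 and has
derivative 1 - (1 + t)e^(-t) ≥ 0. The minorant is quadratic near 0 and linear at infinity, so it
serves before any localization is known. -/
lemma sq_div_le_exp_neg {t : ℝ} (ht : 0 ≤ t) : t ^ 2 / (2 + t) ≤ t + Real.exp (-t) - 1 := by
  have hmono : MonotoneOn (fun t => Real.exp (-t) * (2 + t) - 2 + t) (Set.Ici 0) := by
    have hd : ∀ t : ℝ, HasDerivAt (fun t => Real.exp (-t) * (2 + t) - 2 + t)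
        (1 - (1 + t) * Real.exp (-t)) t := by
      intro t
      have h := ((((hasDerivAt_id t).neg.exp).mul ((hasDerivAt_id t).const_add 2)).sub_const
        2).add (hasDerivAt_id t)
      refine h.congr_deriv ?_
      simp; ring
    refine monotoneOn_of_deriv_nonneg (convex_Ici 0) (fun t _ => (hd t).continuousAt.continuousWithinAt)
      (fun t _ => (hd t).differentiableAt.differentiableWithinAt) fun t _ => ?_
    rw [(hd t).deriv]
    have h1 := Real.add_one_le_exp t
    have h2 : Real.exp t * Real.exp (-t) = 1 := by rw [← Real.exp_add]; simp
    nlinarith [Real.exp_pos (-t), mul_le_mul_of_nonneg_right h1 (Real.exp_pos (-t)).le]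
  have h := hmono (Set.mem_Ici.2 le_rfl) (Set.mem_Ici.2 ht) ht
  simp at h
  rw [div_le_iff₀ (by linarith)]
  nlinarith

/-- Self-concordant lower bound for the Bregman divergence of the log-partition function. -/
lemma softplus_bregman_lower (x a : ℝ) :
    dlink x * (a ^ 2 / (2 + |a|)) ≤ softplus (x + a) - softplus x - Real.sigmoid x * a := by
  have key : ∀ {a : ℝ} (x : ℝ), 0 ≤ a →
      dlink x * (a ^ 2 / (2 + a)) ≤ softplus (x + a) - softplus x - Real.sigmoid x * a := by
    intro a x ha
    -- Integrated form of `sigmoid_increment_lower`: the derivative of this function is the gap in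
    -- that inequality.
    have hmono : MonotoneOn (fun t => softplus (x + t) - softplus x - Real.sigmoid x * t -
        dlink x * (t + Real.exp (-t) - 1)) (Set.Ici 0) := by
      have hd : ∀ t : ℝ, HasDerivAt (fun t => softplus (x + t) - softplus x - Real.sigmoid x * t -
          dlink x * (t + Real.exp (-t) - 1))
          (Real.sigmoid (x + t) - Real.sigmoid x - dlink x * (1 - Real.exp (-t))) t := by
        intro t
        have h1 : HasDerivAt (fun t => softplus (x + t)) (Real.sigmoid (x + t)) t := by
          simpa using (hasDerivAt_softplus (x + t)).comp_const_add x t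
        have h2 := (h1.sub_const (softplus x)).sub ((hasDerivAt_id t).const_mul (Real.sigmoid x))
        have h3 := ((((hasDerivAt_id t).add (hasDerivAt_id t).neg.exp).sub_const 1).const_mul
          (dlink x))
        refine (h2.sub h3).congr_deriv ?_
        simp only [id, Pi.neg_apply]; ring
      refine monotoneOn_of_deriv_nonneg (convex_Ici 0)
        (fun t _ => (hd t).continuousAt.continuousWithinAt)
        (fun t _ => (hd t).differentiableAt.differentiableWithinAt) fun t ht => ?_
      rw [(hd t).deriv]
      rw [interior_Ici] at ht
      linarith [sigmoid_increment_lower (le_of_lt ht) x]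
    have h := hmono (Set.mem_Ici.2 le_rfl) (Set.mem_Ici.2 ha) ha
    simp at h
    linarith [mul_le_mul_of_nonneg_left (sq_div_le_exp_neg ha) (dlink_pos x).le]
  have hsymm : ∀ x, softplus (-x) = softplus x - x := by
    intro x
    have h1 := log_sigmoid (-x)
    rw [Real.sigmoid_neg, log_one_sub_sigmoid] at h1
    linarith
  rcases le_total 0 a with ha | ha
  · rw [abs_of_nonneg ha]; exact key x ha
  · rw [abs_of_nonpos ha]
    have h := key (-x) (neg_nonneg.2 ha)
    rw [dlink_neg, ← neg_add, hsymm, hsymm, Real.sigmoid_neg] at h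
    rw [neg_sq] at h
    linarith

/-- The Taylor remainder is at most (2/9)|x|³ ≤ 0.023 x². The constant 0.53 reappears as the
Chernoff exponent 0.47 = 1 - 0.53. -/
lemma exp_le_quadratic {x : ℝ} (hx : |x| ≤ 0.1) : Real.exp x ≤ 1 + x + 0.53 * x ^ 2 := by
  have h := Real.exp_bound (x := x) (by linarith) (n := 3) (by norm_num)
  have h1 := (abs_le.1 h).2
  simp [Finset.sum_range_succ, Nat.factorial] at h1
  have h2 : |x| ^ 3 ≤ 0.1 * x ^ 2 := by
    rw [pow_succ, sq_abs]; nlinarith [sq_nonneg x]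
  norm_num at h1
  nlinarith

/-- Moment generating function of a centred Bernoulli variable. -/
lemma bernoulli_mgf_le {p a : ℝ} (hp0 : 0 ≤ p) (hp1 : p ≤ 1) (ha : |a| ≤ 0.1) :
    p * Real.exp (a * (1 - p)) + (1 - p) * Real.exp (a * (0 - p)) ≤
      Real.exp (0.53 * (a ^ 2 * (p * (1 - p)))) := by
  have hb : ∀ t : ℝ, |t| ≤ 1 → |a * t| ≤ 0.1 := fun t ht => by
    rw [abs_mul]; nlinarith [abs_nonneg a, abs_nonneg t]
  have h1 := exp_le_quadratic (hb (1 - p) (abs_le.2 ⟨by linarith, by linarith⟩))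
  have h2 := exp_le_quadratic (hb (0 - p) (abs_le.2 ⟨by linarith, by linarith⟩))
  calc _ ≤ p * (1 + a * (1 - p) + 0.53 * (a * (1 - p)) ^ 2) +
        (1 - p) * (1 + a * (0 - p) + 0.53 * (a * (0 - p)) ^ 2) :=
        add_le_add (mul_le_mul_of_nonneg_left h1 hp0)
          (mul_le_mul_of_nonneg_left h2 (sub_nonneg.2 hp1))
    -- The first-order terms cancel and the quadratic ones add up to the variance p(1 - p).
    _ = 0.53 * (a ^ 2 * (p * (1 - p))) + 1 := by ring
    _ ≤ _ := Real.add_one_le_exp _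

/-! ### Information matrices and their dual norms -/

section InfoMatrix

variable {d : ℕ} {ι : Type*} [Fintype ι]

lemma inner_eq_dotProduct (x y : E d) : inner ℝ x y = ⇑x ⬝ᵥ ⇑y := by
  rw [EuclideanSpace.inner_eq_star_dotProduct, star_trivial, dotProduct_comm]

lemma infoMatrix_isHermitian (z : ι → E d) (w : ι → ℝ) : (infoMatrix z w).IsHermitian := by
  ext a b
  simp [infoMatrix, Matrix.sum_apply, Matrix.vecMulVec_apply, mul_comm]

lemma infoMatrix_mulVec (z : ι → E d) (w : ι → ℝ) (v : E d) :
    (infoMatrix z w).mulVec ⇑v = ∑ i, (w i * inner ℝ (z i) v) • ⇑(z i) := by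
  simp only [infoMatrix, Matrix.sum_mulVec, Matrix.smul_mulVec, Matrix.vecMulVec_mulVec,
    inner_eq_dotProduct]
  refine Finset.sum_congr rfl fun i _ => ?_
  ext a
  simp; ring

lemma dotProduct_infoMatrix (z : ι → E d) (w : ι → ℝ) (u v : E d) :
    ⇑u ⬝ᵥ (infoMatrix z w).mulVec ⇑v = ∑ i, w i * inner ℝ (z i) u * inner ℝ (z i) v := by
  rw [infoMatrix_mulVec, dotProduct_sum]
  refine Finset.sum_congr rfl fun i _ => ?_
  rw [dotProduct_smul, ← inner_eq_dotProduct, real_inner_comm (z i) u, smul_eq_mul]; ring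

lemma infoMatrix_posDef_iff (z : ι → E d) (w : ι → ℝ) :
    (infoMatrix z w).PosDef ↔ ∀ v : E d, v ≠ 0 → 0 < ∑ i, w i * inner ℝ (z i) v ^ 2 := by
  have key : ∀ v : E d, ∑ i, w i * inner ℝ (z i) v ^ 2 =
      star ⇑v ⬝ᵥ (infoMatrix z w).mulVec ⇑v := fun v => by
    rw [star_trivial, dotProduct_infoMatrix]
    exact Finset.sum_congr rfl fun i _ => by ring
  rw [Matrix.posDef_iff_dotProduct_mulVec]
  constructor
  · rintro ⟨-, h⟩ v hv
    rw [key]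
    exact h (fun h0 => hv (by ext a; exact congrFun h0 a))
  · intro h
    refine ⟨infoMatrix_isHermitian z w, fun x hx => ?_⟩
    have := h (WithLp.toLp 2 x) (fun h0 => hx (by simpa using h0))
    rwa [key] at this

/-- `M⁻¹ x` as a Euclidean vector. -/
def dualVec (M : Matrix (Fin d) (Fin d) ℝ) (x : E d) : E d := WithLp.toLp 2 (M⁻¹.mulVec ⇑x)

lemma invNormSq_eq_inner (M : Matrix (Fin d) (Fin d) ℝ) (x : E d) :
    invNormSq M x = inner ℝ x (dualVec M x) := by
  rw [inner_eq_dotProduct]; rfl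

lemma mulVec_dualVec {M : Matrix (Fin d) (Fin d) ℝ} (hM : M.PosDef) (x : E d) :
    M.mulVec ⇑(dualVec M x) = ⇑x := by
  have := (Matrix.isUnit_iff_isUnit_det M).1 hM.isUnit
  simp [dualVec, Matrix.mulVec_mulVec, Matrix.mul_nonsing_inv _ this]

/-- The reproducing property of `M⁻¹`. -/
lemma sum_inner_dualVec {z : ι → E d} {w : ι → ℝ} (hM : (infoMatrix z w).PosDef) (x v : E d) :
    ∑ i, w i * inner ℝ (z i) (dualVec (infoMatrix z w) x) * inner ℝ (z i) v = inner ℝ x v := by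
  have h := dotProduct_infoMatrix z w v (dualVec (infoMatrix z w) x)
  rw [mulVec_dualVec hM, ← inner_eq_dotProduct] at h
  rw [real_inner_comm, h]
  exact Finset.sum_congr rfl fun i _ => by ring

lemma inner_dualVec_comm {z : ι → E d} {w : ι → ℝ} (hM : (infoMatrix z w).PosDef) (x y : E d) :
    inner ℝ x (dualVec (infoMatrix z w) y) = inner ℝ y (dualVec (infoMatrix z w) x) := by
  rw [← sum_inner_dualVec hM, ← sum_inner_dualVec hM]
  exact Finset.sum_congr rfl fun i _ => by ring

lemma sum_inner_dualVec_sq {z : ι → E d} {w : ι → ℝ} (hM : (infoMatrix z w).PosDef) (x : E d) :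
    ∑ i, w i * inner ℝ (z i) (dualVec (infoMatrix z w) x) ^ 2 = invNormSq (infoMatrix z w) x := by
  rw [invNormSq_eq_inner, ← sum_inner_dualVec hM]
  exact Finset.sum_congr rfl fun i _ => by ring

lemma invNormSq_nonneg {M : Matrix (Fin d) (Fin d) ℝ} (hM : M.PosDef) (x : E d) :
    0 ≤ invNormSq M x := by
  have := hM.inv.posSemidef.dotProduct_mulVec_nonneg ⇑x
  rwa [star_trivial] at this

lemma invNormSq_pos {M : Matrix (Fin d) (Fin d) ℝ} (hM : M.PosDef) {x : E d} (hx : x ≠ 0) :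
    0 < invNormSq M x := by
  have := hM.inv.dotProduct_mulVec_pos (x := ⇑x) (fun h0 => hx (by ext a; exact congrFun h0 a))
  rwa [star_trivial] at this

/-- Weighted Cauchy-Schwarz inequality. -/
lemma sum_mul_mul_sq_le {w : ι → ℝ} (hw : ∀ i, 0 ≤ w i) (f g : ι → ℝ) :
    (∑ i, w i * f i * g i) ^ 2 ≤ (∑ i, w i * f i ^ 2) * ∑ i, w i * g i ^ 2 := by
  have h := Finset.sum_mul_sq_le_sq_mul_sq Finset.univ (fun i => √(w i) * f i)
    (fun i => √(w i) * g i)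
  have e : ∀ a b : ι → ℝ, ∀ i, √(w i) * a i * (√(w i) * b i) = w i * a i * b i := fun a b i => by
    linear_combination (a i * b i) * Real.mul_self_sqrt (hw i)
  simp only [e, mul_pow, Real.sq_sqrt (hw _)] at h
  exact h

lemma inner_sq_le_invNormSq_mul {z : ι → E d} {w : ι → ℝ} (hw : ∀ i, 0 ≤ w i)
    (hM : (infoMatrix z w).PosDef) (x v : E d) :
    inner ℝ x v ^ 2 ≤ invNormSq (infoMatrix z w) x * ∑ i, w i * inner ℝ (z i) v ^ 2 := by
  rw [← sum_inner_dualVec hM x v, ← sum_inner_dualVec_sq hM]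
  exact sum_mul_mul_sq_le hw _ _

lemma inner_dualVec_sq_le {z : ι → E d} {w : ι → ℝ} (hw : ∀ i, 0 ≤ w i)
    (hM : (infoMatrix z w).PosDef) (x y : E d) :
    inner ℝ x (dualVec (infoMatrix z w) y) ^ 2 ≤
      invNormSq (infoMatrix z w) x * invNormSq (infoMatrix z w) y := by
  have h := inner_sq_le_invNormSq_mul hw hM x (dualVec (infoMatrix z w) y)
  rwa [sum_inner_dualVec_sq hM] at h

lemma infoMatrix_posDef_mono {z : ι → E d} {w w' : ι → ℝ} {t : ℝ} (ht : 0 < t)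
    (hM : (infoMatrix z w).PosDef) (hww : ∀ i, t * w i ≤ w' i) : (infoMatrix z w').PosDef := by
  rw [infoMatrix_posDef_iff] at hM ⊢
  intro v hv
  calc 0 < t * ∑ i, w i * inner ℝ (z i) v ^ 2 := mul_pos ht (hM v hv)
    _ = ∑ i, t * w i * inner ℝ (z i) v ^ 2 := by rw [Finset.mul_sum]; simp only [mul_assoc]
    _ ≤ _ := Finset.sum_le_sum fun i _ => mul_le_mul_of_nonneg_right (hww i) (sq_nonneg _)

/-- Inversion reverses the Loewner order. With v = M'⁻¹x, Cauchy-Schwarz gives N'² ≤ N · vᵀMv, and t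
vᵀMv ≤ vᵀM'v = N'; divide by N'. -/
lemma mul_invNormSq_le {z : ι → E d} {w w' : ι → ℝ} {t : ℝ} (ht : 0 < t) (hw : ∀ i, 0 ≤ w i)
    (hM : (infoMatrix z w).PosDef) (hww : ∀ i, t * w i ≤ w' i) (x : E d) :
    t * invNormSq (infoMatrix z w') x ≤ invNormSq (infoMatrix z w) x := by
  have hM' := infoMatrix_posDef_mono ht hM hww
  set N' := invNormSq (infoMatrix z w') x with hN'
  have h1 := inner_sq_le_invNormSq_mul hw hM x (dualVec (infoMatrix z w') x)
  rw [← invNormSq_eq_inner, ← hN'] at h1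
  have h2 : t * ∑ i, w i * inner ℝ (z i) (dualVec (infoMatrix z w') x) ^ 2 ≤ N' := by
    rw [hN', ← sum_inner_dualVec_sq hM', Finset.mul_sum]
    refine Finset.sum_le_sum fun i _ => ?_
    rw [← mul_assoc]
    exact mul_le_mul_of_nonneg_right (hww i) (sq_nonneg _)
  have h3 : t * N' ^ 2 ≤ invNormSq (infoMatrix z w) x * N' := by
    calc t * N' ^ 2 ≤ t * (invNormSq (infoMatrix z w) x *
          ∑ i, w i * inner ℝ (z i) (dualVec (infoMatrix z w') x) ^ 2) :=
          mul_le_mul_of_nonneg_left h1 ht.le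
      _ = invNormSq (infoMatrix z w) x *
          (t * ∑ i, w i * inner ℝ (z i) (dualVec (infoMatrix z w') x) ^ 2) := by ring
      _ ≤ _ := mul_le_mul_of_nonneg_left h2 (invNormSq_nonneg hM x)
  rcases (invNormSq_nonneg hM' x).eq_or_lt with h0 | h0
  · rw [hN', ← h0, mul_zero]; exact invNormSq_nonneg hM x
  · refine le_of_mul_le_mul_right ?_ h0
    calc t * N' * N' = t * N' ^ 2 := by ring
      _ ≤ _ := h3

/-- The trace of M⁻¹M. This identity turns bounds at single arms into a bound for the full score,
and it forces the objective of every round to be of order at least d². -/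
lemma sum_mul_invNormSq {z : ι → E d} {w : ι → ℝ} (hM : (infoMatrix z w).PosDef) :
    ∑ i, w i * invNormSq (infoMatrix z w) (z i) = d := by
  have hu := (Matrix.isUnit_iff_isUnit_det _).1 hM.isUnit
  have h1 : ((infoMatrix z w)⁻¹ * infoMatrix z w).trace = d := by
    rw [Matrix.nonsing_inv_mul _ hu, Matrix.trace_one, Fintype.card_fin]
  rw [← h1]
  conv_rhs => rw [infoMatrix, Finset.mul_sum, Matrix.trace_sum]
  refine Finset.sum_congr rfl fun i _ => ?_
  rw [Matrix.mul_smul, Matrix.trace_smul, Matrix.mul_vecMulVec, Matrix.trace_vecMulVec,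
    dotProduct_comm]
  rfl

/-- Positive weights on a spanning set give a positive definite information matrix. -/
lemma infoMatrix_posDef_of_pos {z : ι → E d} (hspan : Submodule.span ℝ (Set.range z) = ⊤)
    {w : ι → ℝ} (hw : ∀ i, 0 < w i) : (infoMatrix z w).PosDef := by
  rw [infoMatrix_posDef_iff]
  intro v hv
  by_contra hcon
  have hnn : ∀ i ∈ Finset.univ, 0 ≤ w i * inner ℝ (z i) v ^ 2 :=
    fun i _ => mul_nonneg (hw i).le (sq_nonneg _)
  have h0 := (Finset.sum_eq_zero_iff_of_nonneg hnn).1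
    (le_antisymm (not_lt.1 hcon) (Finset.sum_nonneg hnn))
  have h1 : ∀ i, inner ℝ (z i) v = 0 := fun i => by
    have := h0 i (Finset.mem_univ i)
    simpa [(hw i).ne'] using this
  have h2 : ∀ x ∈ Submodule.span ℝ (Set.range z), inner ℝ x v = 0 := by
    intro x hx
    induction hx using Submodule.span_induction with
    | mem x hx => obtain ⟨i, rfl⟩ := hx; exact h1 i
    | zero => simp
    | add x y _ _ hx hy => rw [inner_add_left, hx, hy, add_zero]
    | smul a x _ hx => rw [inner_smul_left, hx, mul_zero]
  exact hv (inner_self_eq_zero.1 (h2 v (hspan ▸ Submodule.mem_top)))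

end InfoMatrix

/-! ### Optimal designs and rounding -/

section Designs

variable {d : ℕ} {ι : Type*} [Fintype ι]

/-- Carathéodory's theorem for information matrices. -/
lemma exists_sparse_design (z : ι → E d) (u : ι → ℝ) {lam : ι → ℝ} (hlam : lam ∈ stdSimplex ℝ ι) :
    ∃ lam' ∈ stdSimplex ℝ ι,
      infoMatrix z (fun i => lam' i * u i) = infoMatrix z (fun i => lam i * u i) ∧
      (Function.support lam').ncard ≤ d * (d + 1) / 2 + 1 := by
  classical
  -- A symmetric matrix is recorded by its entries on unordered index pairs; this space has
  -- dimension d(d+1)/2, hence the support bound.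
  let φ : ι → Sym2 (Fin d) → ℝ := fun i =>
    Sym2.lift ⟨fun a b => u i * (z i a * z i b), fun a b => by ring⟩
  have hφ : ∀ i a b, φ i s(a, b) = u i * (z i a * z i b) := fun i a b => rfl
  have hentry : ∀ (l : ι → ℝ) a b,
      infoMatrix z (fun i => l i * u i) a b = (∑ i, l i • φ i) s(a, b) := by
    intro l a b
    simp only [infoMatrix, Matrix.sum_apply, Matrix.smul_apply, Matrix.vecMulVec_apply,
      Finset.sum_apply, Pi.smul_apply, hφ, smul_eq_mul]
    exact Finset.sum_congr rfl fun i _ => by ring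
  have hmem : ∑ i, lam i • φ i ∈ convexHull ℝ (Set.range φ) :=
    (convex_convexHull ℝ _).sum_mem (fun i _ => hlam.1 i) hlam.2
      fun i _ => subset_convexHull ℝ _ ⟨i, rfl⟩
  obtain ⟨κ, _, p, w, hp, hind, hw0, hw1, hsum⟩ := eq_pos_convex_span_of_mem_convexHull hmem
  choose g hg using fun k => hp ⟨k, rfl⟩
  let lam' : ι → ℝ := fun i => ∑ k with g k = i, w k
  have hpush : ∀ {V : Type} [AddCommGroup V] [Module ℝ V] (f : ι → V),
      ∑ i, lam' i • f i = ∑ k, w k • f (g k) := by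
    intro V _ _ f
    simp only [lam', Finset.sum_smul]
    rw [← Finset.sum_fiberwise Finset.univ g]
    refine Finset.sum_congr rfl fun i _ => Finset.sum_congr rfl fun k hk => ?_
    rw [(Finset.mem_filter.1 hk).2]
  refine ⟨lam', ⟨fun i => Finset.sum_nonneg fun k _ => (hw0 k).le, ?_⟩, ?_, ?_⟩
  · have := hpush (fun _ => (1 : ℝ))
    simpa [hw1] using this
  · ext a b
    rw [hentry, hentry, ← hsum, hpush φ]
    simp only [hg]
  · have hsub : Function.support lam' ⊆ Set.range g := by
      intro i hi
      by_contra hcon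
      apply hi
      refine Finset.sum_eq_zero fun k hk => ?_
      exact absurd ⟨k, (Finset.mem_filter.1 hk).2⟩ hcon
    calc (Function.support lam').ncard ≤ (Set.range g).ncard :=
          Set.ncard_le_ncard hsub (Set.toFinite _)
      _ ≤ Fintype.card κ := by
          rw [← Set.image_univ]
          refine (Set.ncard_image_le (Set.toFinite _)).trans ?_
          rw [Set.ncard_univ, Nat.card_eq_fintype_card]
      _ ≤ Module.finrank ℝ (vectorSpan ℝ (Set.range p)) + 1 := hind.card_le_finrank_succ
      _ ≤ Module.finrank ℝ (Sym2 (Fin d) → ℝ) + 1 := by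
          gcongr; exact Submodule.finrank_le _
      _ = d * (d + 1) / 2 + 1 := by
          rw [Module.finrank_fintype_fun_eq_card, Sym2.card, Fintype.card_fin,
            Nat.choose_two_right, Nat.add_sub_cancel, mul_comm]

/-! ### Existence of optimal designs by compactness. -/

lemma continuousOn_invNormSq (x : E d) :
    ContinuousOn (fun M : Matrix (Fin d) (Fin d) ℝ => invNormSq M x) {M | M.PosDef} := by
  have hinv : ContinuousOn (fun M : Matrix (Fin d) (Fin d) ℝ => M⁻¹) {M | M.PosDef} := by
    intro M hM
    have hdet : M.det ≠ 0 := ((Matrix.isUnit_iff_isUnit_det M).1 hM.isUnit).ne_zero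
    simp only [Matrix.inv_def, Ring.inverse_eq_inv']
    exact ((continuous_id.matrix_det.continuousAt.inv₀ hdet).smul
      continuous_id.matrix_adjugate.continuousAt).continuousWithinAt
  have hc : Continuous fun M : Matrix (Fin d) (Fin d) ℝ => ⇑x ⬝ᵥ M.mulVec ⇑x :=
    continuous_const.dotProduct (continuous_id.matrix_mulVec continuous_const)
  exact hc.comp_continuousOn hinv

lemma continuousOn_iSup_of_finite {X κ : Type*} [TopologicalSpace X] [Finite κ] {s : Set X}
    {f : κ → X → ℝ} (hf : ∀ k, ContinuousOn (f k) s) : ContinuousOn (fun x => ⨆ k, f k x) s := by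
  have := Fintype.ofFinite κ
  rcases isEmpty_or_nonempty κ with h | h
  · simp only [Real.iSup_of_isEmpty]; exact continuousOn_const
  · simp only [← Finset.sup'_univ_eq_ciSup]
    exact ContinuousOn.finset_sup'_apply _ fun k _ => hf k

lemma continuous_infoMatrix (z : ι → E d) (u : ι → ℝ) :
    Continuous fun w : ι → ℝ => infoMatrix z (fun i => w i * u i) := by
  unfold infoMatrix
  fun_prop

lemma uniform_mem_stdSimplex [Nonempty ι] :
    (fun _ : ι => (Fintype.card ι : ℝ)⁻¹) ∈ stdSimplex ℝ ι :=
  ⟨fun _ => by positivity, by simp⟩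

/-- Existence of sparse optimal designs for coercive objectives. -/
lemma exists_isOptimalDesign [Nonempty ι] {z : ι → E d}
    (hspan : Submodule.span ℝ (Set.range z) = ⊤) {u : ι → ℝ} (hu : ∀ i, 0 < u i)
    {Φ : Matrix (Fin d) (Fin d) ℝ → ℝ} (hΦ : ContinuousOn Φ {M | M.PosDef}) {c : ℝ} (hc : 0 < c)
    (hco : ∀ M : Matrix (Fin d) (Fin d) ℝ, M.PosDef → ∀ i, c * invNormSq M (z i) ≤ Φ M) :
    ∃ lam, IsOptimalDesign (fun w => infoMatrix z (fun i => w i * u i))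
      (fun w => Φ (infoMatrix z (fun i => w i * u i))) lam := by
  set M : (ι → ℝ) → Matrix (Fin d) (Fin d) ℝ := fun w => infoMatrix z (fun i => w i * u i) with hM
  set un : ι → ℝ := fun _ => (Fintype.card ι : ℝ)⁻¹ with hun
  have hunS : un ∈ stdSimplex ℝ ι := uniform_mem_stdSimplex
  have hunP : (M un).PosDef := infoMatrix_posDef_of_pos hspan fun i => by
    have := hu i; simp only [un]; positivity
  let Q : (ι → ℝ) → E d → ℝ := fun w v => ∑ i, w i * u i * inner ℝ (z i) v ^ 2
  -- `C` replaces positive definiteness, which is not closed, by the closed condition M(un) ≤ B ·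
  -- M(w). By coercivity each ⟨z_i, v⟩² is at most (Φ(M un)/c) · Q w v on the sublevel set of `un`;
  -- summing with weights `un i * u i` produces B.
  set B : ℝ := (∑ i, un i * u i) * (Φ (M un) / c) with hB
  let C : Set (ι → ℝ) := stdSimplex ℝ ι ∩ {w | ∀ v, Q un v ≤ B * Q w v}
  have hQ0 : ∀ w ∈ stdSimplex ℝ ι, ∀ v, 0 ≤ Q w v := fun w hw v =>
    Finset.sum_nonneg fun i _ => mul_nonneg (mul_nonneg (hw.1 i) (hu i).le) (sq_nonneg _)
  have hCP : ∀ w ∈ C, (M w).PosDef := by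
    rintro w ⟨hw, hwB⟩
    rw [hM, infoMatrix_posDef_iff]
    intro v hv
    have h1 : 0 < Q un v := (infoMatrix_posDef_iff _ _).1 hunP v hv
    refine (hQ0 w hw v).lt_of_ne fun h0 => ?_
    have h2 := hwB v
    rw [← h0, mul_zero] at h2
    linarith
  have hsub : ∀ w ∈ stdSimplex ℝ ι, (M w).PosDef → Φ (M w) ≤ Φ (M un) → w ∈ C := by
    intro w hw hwP hwle
    refine ⟨hw, fun v => ?_⟩
    have h1 : ∀ i, inner ℝ (z i) v ^ 2 ≤ Φ (M un) / c * Q w v := by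
      intro i
      refine (inner_sq_le_invNormSq_mul (fun i => mul_nonneg (hw.1 i) (hu i).le) hwP _ v).trans ?_
      refine mul_le_mul_of_nonneg_right ?_ (hQ0 w hw v)
      rw [le_div_iff₀ hc, mul_comm]
      exact (hco _ hwP i).trans hwle
    calc Q un v ≤ ∑ i, un i * u i * (Φ (M un) / c * Q w v) :=
          Finset.sum_le_sum fun i _ => mul_le_mul_of_nonneg_left (h1 i)
            (mul_nonneg (hunS.1 i) (hu i).le)
      _ = B * Q w v := by rw [← Finset.sum_mul, hB]; ring
  have hCc : IsCompact C := by
    refine (isCompact_stdSimplex ℝ ι).inter_right ?_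
    have : {w : ι → ℝ | ∀ v, Q un v ≤ B * Q w v} = ⋂ v, {w | Q un v ≤ B * Q w v} := by
      ext; simp
    rw [this]
    refine isClosed_iInter fun v => isClosed_le continuous_const ?_
    simp only [Q]
    fun_prop
  have hcont : ContinuousOn (fun w => Φ (M w)) C :=
    hΦ.comp (continuous_infoMatrix z u).continuousOn hCP
  obtain ⟨w, hwC, hwmin⟩ := hCc.exists_isMinOn ⟨un, hsub un hunS hunP le_rfl⟩ hcont
  -- The objective sees only the matrix, so thinning the support by Carathéodory preserves
  -- minimality.
  obtain ⟨w', hw'S, hw'M, hw'card⟩ := exists_sparse_design z u hwC.1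
  have hMw : M w' = M w := hw'M
  refine ⟨w', ⟨hw'S, hMw ▸ hCP w hwC⟩, fun l hl hlP => ?_, hw'card⟩
  change Φ (M w') ≤ Φ (M l)
  rw [hMw]
  by_cases hle : Φ (M l) ≤ Φ (M un)
  · exact hwmin (hsub l hl hlP hle)
  · exact (hwmin (hsub un hunS hunP le_rfl)).trans (not_le.1 hle).le

lemma exists_isOptimalDesign_gObjective [Nonempty ι] {z : ι → E d}
    (hspan : Submodule.span ℝ (Set.range z) = ⊤) :
    ∃ lam, IsOptimalDesign (infoMatrix z) (gObjective z) lam := by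
  have h := exists_isOptimalDesign hspan (u := fun _ => 1) (fun _ => one_pos)
    (Φ := fun M => ⨆ i, invNormSq M (z i))
    (continuousOn_iSup_of_finite fun i => continuousOn_invNormSq (z i)) one_pos
    (fun M _ i => by
      rw [one_mul]
      exact le_ciSup (f := fun i => invNormSq M (z i)) (Set.finite_range _).bddAbove i)
  simp only [mul_one] at h
  exact h

/-- The γ-term runs over all arms and makes the objective coercive, even for empty `A`, where the
second supremum is 0. -/
lemma exists_isOptimalDesign_objective [Nonempty ι] {z : ι → E d}
    (hspan : Submodule.span ℝ (Set.range z) = ⊤) {δ : ℝ} (hγ : 0 < gam ι d δ) (l : ℕ)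
    (A : Finset ι) (θ : E d) :
    ∃ lam, IsOptimalDesign (fun w => fisher z w θ) (objective z δ l A θ) lam := by
  refine exists_isOptimalDesign hspan (u := fun i => dlink (inner ℝ (z i) θ))
    (fun i => dlink_pos _)
    (Φ := fun M => max (gam ι d δ * ⨆ i, invNormSq M (z i))
      (2.4 ^ 2 * (eps l ^ 2)⁻¹ * ⨆ i : {i // i ∈ A}, invNormSq M (z i)))
    ?_ hγ fun M _ i => le_max_of_le_left ?_
  · refine ContinuousOn.sup ?_ ?_
    · exact continuousOn_const.mul
        (continuousOn_iSup_of_finite fun i => continuousOn_invNormSq (z i))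
    · exact continuousOn_const.mul
        (continuousOn_iSup_of_finite fun i : {i // i ∈ A} => continuousOn_invNormSq (z i))
  · exact mul_le_mul_of_nonneg_left
      (le_ciSup (f := fun i => invNormSq M (z i)) (Set.finite_range _).bddAbove i) hγ.le

/-- Factor out M and use the determinant of a rank-one perturbation of the identity. It makes the
determinant explicit along segments towards a vertex of the simplex. -/
lemma det_add_smul_vecMulVec {M : Matrix (Fin d) (Fin d) ℝ} (hM : M.PosDef) (s : ℝ) (x : E d) :
    (M + s • Matrix.vecMulVec ⇑x ⇑x).det = M.det * (1 + s * invNormSq M x) := by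
  have hu := (Matrix.isUnit_iff_isUnit_det M).1 hM.isUnit
  have h : M + s • Matrix.vecMulVec ⇑x ⇑x =
      M * (1 + Matrix.replicateCol Unit (s • M⁻¹.mulVec ⇑x) * Matrix.replicateRow Unit ⇑x) := by
    rw [← Matrix.vecMulVec_eq, mul_add, mul_one, Matrix.mul_vecMulVec, Matrix.mulVec_smul,
      Matrix.mulVec_mulVec, Matrix.mul_nonsing_inv _ hu, Matrix.one_mulVec, Matrix.smul_vecMulVec]
  rw [h, Matrix.det_mul, Matrix.det_one_add_replicateCol_mul_replicateRow, dotProduct_smul]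
  rfl

lemma infoMatrix_posDef_of_det_ne_zero {z : ι → E d} {w : ι → ℝ} (hw : ∀ i, 0 ≤ w i)
    (hdet : (infoMatrix z w).det ≠ 0) : (infoMatrix z w).PosDef := by
  rw [infoMatrix_posDef_iff]
  intro v hv
  have hnn : ∀ i ∈ Finset.univ, 0 ≤ w i * inner ℝ (z i) v ^ 2 :=
    fun i _ => mul_nonneg (hw i) (sq_nonneg _)
  refine (Finset.sum_nonneg hnn).lt_of_ne fun h0 => hv ?_
  have h1 := (Finset.sum_eq_zero_iff_of_nonneg hnn).1 h0.symm
  have h2 : (infoMatrix z w).mulVec ⇑v = 0 := by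
    rw [infoMatrix_mulVec]
    refine Finset.sum_eq_zero fun i hi => ?_
    have : w i * inner ℝ (z i) v = 0 := by
      rcases mul_eq_zero.1 (h1 i hi) with h | h
      · rw [h, zero_mul]
      · rw [pow_eq_zero_iff two_ne_zero] at h; rw [h, mul_zero]
    rw [this, zero_smul]
  have h3 := Matrix.eq_zero_of_mulVec_eq_zero hdet h2
  ext a; exact congrFun h3 a

/-- The Kiefer-Wolfowitz bound: some design has all dual norms at most `d`. -/
lemma exists_design_invNormSq_le [Nonempty ι] {z : ι → E d}
    (hspan : Submodule.span ℝ (Set.range z) = ⊤) :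
    ∃ lam ∈ stdSimplex ℝ ι, (infoMatrix z lam).PosDef ∧
      ∀ i, invNormSq (infoMatrix z lam) (z i) ≤ d := by
  classical
  have hcont : Continuous fun w : ι → ℝ => (infoMatrix z w).det := by
    have := (continuous_infoMatrix z (fun _ => 1)).matrix_det
    simpa only [mul_one] using this
  -- The witness is the D-optimal design; its first-order optimality towards each vertex is the
  -- desired bound.
  obtain ⟨lam, hlam, hmax⟩ := (isCompact_stdSimplex ℝ ι).exists_isMaxOn
    ⟨_, uniform_mem_stdSimplex⟩ hcont.continuousOn
  have hun : (infoMatrix z (fun _ : ι => (Fintype.card ι : ℝ)⁻¹)).PosDef :=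
    infoMatrix_posDef_of_pos hspan fun i => by positivity
  have hdet : 0 < (infoMatrix z lam).det := hun.det_pos.trans_le (hmax uniform_mem_stdSimplex)
  have hP := infoMatrix_posDef_of_det_ne_zero hlam.1 hdet.ne'
  refine ⟨lam, hlam, hP, fun i => ?_⟩
  set g := invNormSq (infoMatrix z lam) (z i) with hg
  -- Mixing in arm `i` with relative weight s multiplies the determinant by (1 + s g)/(1 + s)^d,
  -- which cannot exceed 1.
  have key : ∀ s : ℝ, 0 < s → 1 + s * g ≤ (1 + s) ^ d := by
    intro s hs
    let w : ι → ℝ := fun j => (1 + s)⁻¹ * (lam j + s * (Pi.single i 1 : ι → ℝ) j)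
    have hwS : w ∈ stdSimplex ℝ ι := by
      constructor
      · intro j
        have h1 := hlam.1 j
        have h2 : 0 ≤ (Pi.single i 1 : ι → ℝ) j := by
          rw [Pi.single_apply]; split_ifs <;> norm_num
        simp only [w]; positivity
      · simp only [w]
        rw [← Finset.mul_sum, Finset.sum_add_distrib, ← Finset.mul_sum, hlam.2]
        simp
        field_simp
    have hwM : infoMatrix z w =
        (1 + s)⁻¹ • (infoMatrix z lam + s • Matrix.vecMulVec ⇑(z i) ⇑(z i)) := by
      simp only [infoMatrix, w, mul_smul, add_smul, ← Finset.smul_sum, Finset.sum_add_distrib]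
      simp [Pi.single_apply]
    have h := hmax hwS
    simp only [Set.mem_ofPred_eq, hwM, Matrix.det_smul, Fintype.card_fin,
      det_add_smul_vecMulVec hP] at h
    rw [inv_pow, inv_mul_le_iff₀ (by positivity), mul_comm ((1 + s) ^ d)] at h
    exact le_of_mul_le_mul_left h hdet
  refine le_of_forall_pos_le_add fun ε hε => ?_
  have hd0 : (0 : ℝ) ≤ d := Nat.cast_nonneg d
  -- The first entry gives sd ≤ 1, so that e^(sd) ≤ 1 + sd + (sd)²; the second gives sd² ≤ ε, so
  -- this is at most 1 + s(d + ε).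
  set s : ℝ := min (1 / (d + 1)) (ε / ((d : ℝ) ^ 2 + 1)) with hs
  have hs0 : 0 < s := lt_min (by positivity) (by positivity)
  have hs1 : s * d ≤ 1 := by
    have : s ≤ 1 / (d + 1) := min_le_left _ _
    rw [le_div_iff₀ (by positivity)] at this
    nlinarith
  have hs2 : s * (d : ℝ) ^ 2 ≤ ε := by
    have : s ≤ ε / ((d : ℝ) ^ 2 + 1) := min_le_right _ _
    rw [le_div_iff₀ (by positivity)] at this
    nlinarith
  have h1 : (1 + s) ^ d ≤ Real.exp (s * d) := by
    rw [mul_comm, Real.exp_nat_mul]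
    exact pow_le_pow_left₀ (by positivity) (by linarith [Real.add_one_le_exp s]) d
  have h2 := (abs_le.1 (Real.abs_exp_sub_one_sub_id_le (x := s * d)
    (by rw [abs_of_nonneg (by positivity)]; exact hs1))).2
  have h3 : s * g ≤ s * (d + ε) := by nlinarith [key s hs0]
  exact le_of_mul_le_mul_left h3 hs0

/-- Roundings exist for every number of pulls. -/
lemma exists_isRounding {lam : ι → ℝ} (hlam : lam ∈ stdSimplex ℝ ι) (n : ℕ) :
    ∃ c, IsRounding lam n c := by
  classical
  have hne : (Finset.univ.filter fun i => lam i ≠ 0).Nonempty := by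
    by_contra hcon
    rw [Finset.not_nonempty_iff_eq_empty, Finset.filter_eq_empty_iff] at hcon
    have h1 : ∑ i, lam i = 0 := Finset.sum_eq_zero fun i hi => not_not.1 (hcon hi)
    rw [hlam.2] at h1
    exact one_ne_zero h1
  have hpos : ∀ i, lam i ≠ 0 → 0 < lam i := fun i hi => (hlam.1 i).lt_of_ne hi.symm
  induction n with
  | zero => exact ⟨0, by simp, fun _ _ => rfl, 0, le_rfl, fun i _ => by simp⟩
  | succ n ih =>
    obtain ⟨c, hsum, hzero, ν, hν, hc⟩ := ih
    -- Greedy apportionment: the next pull goes to the support arm with least c/lam, and this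
    -- quotient is the new multiplier. Minimality gives the lower bounds; the multiplier does not
    -- decrease, so the upper bounds persist.
    obtain ⟨j, hj, hmin⟩ := Finset.exists_min_image _ (fun i => (c i : ℝ) / lam i) hne
    have hj0 : lam j ≠ 0 := (Finset.mem_filter.1 hj).2
    have hlow : ∀ i, lam i ≠ 0 → c j / lam j * lam i ≤ c i := by
      intro i hi
      have h := hmin i (Finset.mem_filter.2 ⟨Finset.mem_univ i, hi⟩)
      rwa [le_div_iff₀ (hpos i hi)] at h
    have hνj : ν ≤ c j / lam j := by rw [le_div_iff₀ (hpos j hj0)]; exact (hc j hj0).1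
    refine ⟨Function.update c j (c j + 1), ?_, fun i hi => ?_, c j / lam j,
      hν.trans hνj, fun i hi => ?_⟩
    · rw [Finset.sum_update_of_mem (Finset.mem_univ j), ← hsum,
        ← Finset.add_sum_erase _ _ (Finset.mem_univ j), Finset.sdiff_singleton_eq_erase]
      ring
    · rw [Function.update_of_ne (by rintro rfl; exact hj0 hi)]
      exact hzero i hi
    · rcases eq_or_ne i j with rfl | hij
      · have h0 : (c i : ℝ) / lam i * lam i = c i := div_mul_cancel₀ _ hi
        simp [h0]
      · rw [Function.update_of_ne hij]
        refine ⟨hlow i hi, (hc i hi).2.trans ?_⟩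
        have := mul_le_mul_of_nonneg_right hνj (hpos i hi).le
        linarith

/-- Rounding up adds at most one pull per support point, so the multiplier is at least n minus the
size of the support. -/
lemma IsRounding.mul_le {lam : ι → ℝ} (hlam : lam ∈ stdSimplex ℝ ι) {n : ℕ} {c : ι → ℕ}
    (hc : IsRounding lam n c) (i : ι) :
    ((n : ℝ) - (Function.support lam).ncard) * lam i ≤ c i := by
  classical
  obtain ⟨hsum, hzero, ν, hν, hb⟩ := hc
  have hn : (n : ℝ) ≤ ν + (Function.support lam).ncard := by
    have h1 : (Function.support lam).ncard = (Finset.univ.filter fun i => lam i ≠ 0).card := by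
      rw [← Set.ncard_coe_finset]; congr 1; ext; simp
    rw [← hsum, Nat.cast_sum, h1, Finset.card_filter, Nat.cast_sum]
    calc ∑ i, (c i : ℝ) ≤ ∑ i, (ν * lam i + ((if lam i ≠ 0 then 1 else 0 : ℕ) : ℝ)) := by
          refine Finset.sum_le_sum fun i _ => ?_
          by_cases h : lam i = 0
          · simp [h, hzero i h]
          · simpa [h] using (hb i h).2
      _ = _ := by rw [Finset.sum_add_distrib, ← Finset.mul_sum, hlam.2, mul_one]
  by_cases h : lam i = 0
  · simp [h]
  · exact (mul_le_mul_of_nonneg_right (by linarith) (hlam.1 i)).trans (hb i h).1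

end Designs

/-! ### Maximum likelihood estimates -/

section MLE

lemma weight_nonneg {d : ℕ} {ι : Type*} (z : ι → E d) (θ₀ : E d) (c : ι → ℕ) (i : ι) :
    0 ≤ (c i : ℝ) * dlink (inner ℝ (z i) θ₀) :=
  mul_nonneg (Nat.cast_nonneg _) (dlink_pos _).le

variable {d : ℕ} {ι : Type*} [Fintype ι] {z : ι → E d} {c : ι → ℕ}
  {y : (i : ι) → Fin (c i) → Bool} {θ₀ : E d}

/-- Sum of the centred labels of arm `i`. -/
def score (z : ι → E d) (θ₀ : E d) (c : ι → ℕ) (y : (i : ι) → Fin (c i) → Bool) (i : ι) : ℝ :=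
  ∑ j, ((if y i j then 1 else 0) - Real.sigmoid (inner ℝ (z i) θ₀))

/-- The Fisher information at `θ₀` of `c i` pulls of each arm `i`. -/
def dataInfo (z : ι → E d) (θ₀ : E d) (c : ι → ℕ) : Matrix (Fin d) (Fin d) ℝ :=
  fisher z (fun i => (c i : ℝ)) θ₀

/-- The first-order approximation of the estimation error in the direction of arm `k`. -/
def linError (z : ι → E d) (θ₀ : E d) (c : ι → ℕ) (y : (i : ι) → Fin (c i) → Bool) (k : ι) : ℝ :=
  ∑ i, score z θ₀ c y i * inner ℝ (z i) (dualVec (dataInfo z θ₀ c) (z k))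

/-- Exponential-family form. The reference point `θ₀` cancels; it only splits the linear coefficient
into noise and mean. -/
lemma logLik_eq (z : ι → E d) (θ₀ : E d) (c : ι → ℕ) (y : (i : ι) → Fin (c i) → Bool) (θ : E d) :
    logLik z c y θ = ∑ i, ((score z θ₀ c y i + c i * Real.sigmoid (inner ℝ (z i) θ₀)) *
      inner ℝ (z i) θ - c i * softplus (inner ℝ (z i) θ)) := by
  refine Finset.sum_congr rfl fun i _ => ?_
  have h : ∀ j, (if y i j then Real.log (Real.sigmoid (inner ℝ (z i) θ))
      else Real.log (1 - Real.sigmoid (inner ℝ (z i) θ))) =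
      (if y i j then 1 else 0) * inner ℝ (z i) θ - softplus (inner ℝ (z i) θ) := by
    intro j
    rw [log_sigmoid, log_one_sub_sigmoid]
    split_ifs <;> ring
  simp only [h, score, Finset.sum_sub_distrib, ← Finset.sum_mul, Finset.sum_const,
    Finset.card_univ, Fintype.card_fin, nsmul_eq_mul]
  ring

/-- Noise term minus a Bregman divergence of the log-partition function: the form to which the
self-concordant lower bound applies. -/
lemma logLik_sub (z : ι → E d) (θ₀ : E d) (c : ι → ℕ) (y : (i : ι) → Fin (c i) → Bool) (θ : E d) :
    logLik z c y θ - logLik z c y θ₀ =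
      ∑ i, score z θ₀ c y i * inner ℝ (z i) (θ - θ₀) -
      ∑ i, c i * (softplus (inner ℝ (z i) θ₀ + inner ℝ (z i) (θ - θ₀)) -
        softplus (inner ℝ (z i) θ₀) -
        Real.sigmoid (inner ℝ (z i) θ₀) * inner ℝ (z i) (θ - θ₀)) := by
  rw [logLik_eq z θ₀, logLik_eq z θ₀, ← Finset.sum_sub_distrib, ← Finset.sum_sub_distrib]
  refine Finset.sum_congr rfl fun i _ => ?_
  rw [inner_sub_right, add_sub_cancel]
  ring

/-- First-order optimality condition. -/
lemma IsMLE.sum_eq_zero {θ : E d} (h : IsMLE z c y θ) (θ₀ v : E d) :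
    ∑ i, c i * (Real.sigmoid (inner ℝ (z i) θ) - Real.sigmoid (inner ℝ (z i) θ₀)) *
      inner ℝ (z i) v = ∑ i, score z θ₀ c y i * inner ℝ (z i) v := by
  have hd : HasDerivAt (fun t : ℝ => logLik z c y (θ + t • v))
      (∑ i, ((score z θ₀ c y i + c i * Real.sigmoid (inner ℝ (z i) θ₀)) *
        inner ℝ (z i) v - c i * (Real.sigmoid (inner ℝ (z i) θ) * inner ℝ (z i) v))) 0 := by
    simp only [logLik_eq z θ₀]
    refine HasDerivAt.fun_sum fun i _ => ?_
    have h1 : HasDerivAt (fun t : ℝ => inner ℝ (z i) (θ + t • v)) (inner ℝ (z i) v) 0 := by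
      simp only [inner_add_right, inner_smul_right]
      simpa using ((hasDerivAt_id (0 : ℝ)).mul_const (inner ℝ (z i) v)).const_add
        (inner ℝ (z i) θ)
    have h2 : HasDerivAt (fun t : ℝ => softplus (inner ℝ (z i) (θ + t • v)))
        (Real.sigmoid (inner ℝ (z i) θ) * inner ℝ (z i) v) 0 := by
      have h3 : HasDerivAt softplus (Real.sigmoid (inner ℝ (z i) θ))
          (inner ℝ (z i) (θ + (0 : ℝ) • v)) := by
        simpa using hasDerivAt_softplus (inner ℝ (z i) θ)
      have h4 := h3.comp (0 : ℝ) h1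
      exact h4
    exact (h1.const_mul _).sub (h2.const_mul _)
  have hmax : IsLocalMax (fun t : ℝ => logLik z c y (θ + t • v)) 0 :=
    Filter.Eventually.of_forall fun t => by simpa using h (θ + t • v)
  have h0 := hmax.hasDerivAt_eq_zero hd
  rw [← sub_eq_zero, ← Finset.sum_sub_distrib, ← neg_eq_zero, ← Finset.sum_neg_distrib, ← h0]
  exact Finset.sum_congr rfl fun i _ => by ring

lemma continuous_logLik : Continuous (logLik z c y) := by
  have hs : Continuous softplus :=
    continuous_iff_continuousAt.2 fun x => (hasDerivAt_softplus x).continuousAt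
  have : logLik z c y = fun θ => ∑ i, ((score z 0 c y i +
      c i * Real.sigmoid (inner ℝ (z i) (0 : E d))) * inner ℝ (z i) θ -
      c i * softplus (inner ℝ (z i) θ)) := funext fun θ => logLik_eq z 0 c y θ
  rw [this]
  fun_prop

/-- The score is controlled by the linearized errors. -/
lemma score_sum_eq (hP : (dataInfo z θ₀ c).PosDef) (v : E d) :
    ∑ i, score z θ₀ c y i * inner ℝ (z i) v =
      ∑ k, c k * dlink (inner ℝ (z k) θ₀) * linError z θ₀ c y k * inner ℝ (z k) v := by
  -- Inserting M M⁻¹ and using the symmetry of M⁻¹ moves the sum over i into the linear errors.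
  have h : ∀ i, inner ℝ (z i) v = ∑ k, c k * dlink (inner ℝ (z k) θ₀) *
      inner ℝ (z i) (dualVec (dataInfo z θ₀ c) (z k)) * inner ℝ (z k) v := by
    intro i
    rw [← sum_inner_dualVec hP (z i) v]
    refine Finset.sum_congr rfl fun k _ => ?_
    congr 2
    exact inner_dualVec_comm hP _ _
  calc _ = ∑ i, ∑ k, score z θ₀ c y i * (c k * dlink (inner ℝ (z k) θ₀) *
      inner ℝ (z i) (dualVec (dataInfo z θ₀ c) (z k)) * inner ℝ (z k) v) :=
        Finset.sum_congr rfl fun i _ => by rw [h i, Finset.mul_sum]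
    _ = _ := by
        rw [Finset.sum_comm]
        refine Finset.sum_congr rfl fun k _ => ?_
        rw [linError, Finset.mul_sum, Finset.sum_mul]
        exact Finset.sum_congr rfl fun i _ => by ring

/-- A batch whose linearized errors are small compared with the information in the batch. -/
structure RegularBatch (z : ι → E d) (θ₀ : E d) (c : ι → ℕ) (y : (i : ι) → Fin (c i) → Bool)
    (b : ℝ) : Prop where
  posDef : (dataInfo z θ₀ c).PosDef
  nonneg : 0 ≤ b
  leverage : ∀ i, √(invNormSq (dataInfo z θ₀ c) (z i)) * (√d * b) ≤ 0.1
  linError_le : ∀ k, |linError z θ₀ c y k| ≤ b * √(invNormSq (dataInfo z θ₀ c) (z k))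

/-- The length of `v` in the norm of the Fisher information. -/
def infoNorm (z : ι → E d) (θ₀ : E d) (c : ι → ℕ) (v : E d) : ℝ :=
  √(∑ i, c i * dlink (inner ℝ (z i) θ₀) * inner ℝ (z i) v ^ 2)

lemma infoNorm_nonneg (v : E d) : 0 ≤ infoNorm z θ₀ c v := Real.sqrt_nonneg _

lemma infoNorm_sq (v : E d) :
    infoNorm z θ₀ c v ^ 2 = ∑ i, c i * dlink (inner ℝ (z i) θ₀) * inner ℝ (z i) v ^ 2 :=
  Real.sq_sqrt (Finset.sum_nonneg fun i _ => mul_nonneg (weight_nonneg z θ₀ c i) (sq_nonneg _))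

lemma abs_inner_le_infoNorm (hP : (dataInfo z θ₀ c).PosDef) (x v : E d) :
    |inner ℝ x v| ≤ √(invNormSq (dataInfo z θ₀ c) x) * infoNorm z θ₀ c v := by
  rw [infoNorm, ← Real.sqrt_mul (invNormSq_nonneg hP x)]
  exact Real.abs_le_sqrt (inner_sq_le_invNormSq_mul (weight_nonneg z θ₀ c) hP x v)

namespace RegularBatch

variable {b : ℝ}

lemma abs_score_sum_le (h : RegularBatch z θ₀ c y b) (v : E d) :
    |∑ i, score z θ₀ c y i * inner ℝ (z i) v| ≤ √d * b * infoNorm z θ₀ c v := by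
  -- Since tr(M⁻¹M) = d, the armwise bounds yield a bound √d b on the dual norm of the score.
  have hT : ∑ k, c k * dlink (inner ℝ (z k) θ₀) * linError z θ₀ c y k ^ 2 ≤ d * b ^ 2 := by
    calc _ ≤ ∑ k, c k * dlink (inner ℝ (z k) θ₀) *
          (b ^ 2 * invNormSq (dataInfo z θ₀ c) (z k)) := by
          refine Finset.sum_le_sum fun k _ =>
            mul_le_mul_of_nonneg_left ?_ (weight_nonneg z θ₀ c k)
          have := pow_le_pow_left₀ (abs_nonneg _) (h.linError_le k) 2
          rwa [sq_abs, mul_pow, Real.sq_sqrt (invNormSq_nonneg h.posDef _)] at this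
      _ = b ^ 2 * ∑ k, c k * dlink (inner ℝ (z k) θ₀) * invNormSq (dataInfo z θ₀ c) (z k) := by
          rw [Finset.mul_sum]; exact Finset.sum_congr rfl fun k _ => by ring
      _ = d * b ^ 2 := by
          have := sum_mul_invNormSq h.posDef
          rw [dataInfo, fisher, this]; ring
  have hcs := sum_mul_mul_sq_le (weight_nonneg z θ₀ c) (linError z θ₀ c y)
    (fun k => inner ℝ (z k) v)
  rw [score_sum_eq h.posDef]
  refine abs_le_of_sq_le_sq ?_ (mul_nonneg (mul_nonneg (Real.sqrt_nonneg _) h.nonneg)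
    (infoNorm_nonneg v))
  refine hcs.trans ?_
  rw [← infoNorm_sq, mul_pow, mul_pow, Real.sq_sqrt (Nat.cast_nonneg d)]
  exact mul_le_mul_of_nonneg_right hT (sq_nonneg _)

/-- Parameters at least as likely as the true one are close to it. -/
lemma abs_inner_le_of_logLik_le (h : RegularBatch z θ₀ c y b) {θ : E d} (hθ : logLik z c y θ₀ ≤ logLik z c y θ) (i : ι) :
    |inner ℝ (z i) (θ - θ₀)| ≤ 0.23 := by
  set v := θ - θ₀ with hv
  set q := infoNorm z θ₀ c v with hq
  set B := √d * b with hB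
  have hq0 : 0 ≤ q := infoNorm_nonneg v
  have hB0 : 0 ≤ B := mul_nonneg (Real.sqrt_nonneg _) h.nonneg
  have : Nonempty ι := ⟨i⟩
  obtain ⟨m, hm⟩ := Finite.exists_max fun i => √(invNormSq (dataInfo z θ₀ c) (z i))
  set x := √(invNormSq (dataInfo z θ₀ c) (z m)) with hx
  have hx0 : 0 ≤ x := Real.sqrt_nonneg _
  have hg : ∀ i, |inner ℝ (z i) v| ≤ x * q := fun i =>
    (abs_inner_le_infoNorm h.posDef _ _).trans (mul_le_mul_of_nonneg_right (hm i) hq0)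
  have hxB : x * B ≤ 0.1 := h.leverage m
  -- Each denominator 2 + |z_iᵀv| is enlarged to the common 2 + xq, after which the sum is exactly
  -- q².
  have hbreg : q ^ 2 / (2 + x * q) ≤ ∑ i, c i * (softplus (inner ℝ (z i) θ₀ + inner ℝ (z i) v) -
        softplus (inner ℝ (z i) θ₀) - Real.sigmoid (inner ℝ (z i) θ₀) * inner ℝ (z i) v) := by
    rw [hq, infoNorm_sq, Finset.sum_div]
    refine Finset.sum_le_sum fun i _ => ?_
    rw [mul_assoc, mul_div_assoc, mul_div_assoc]
    refine mul_le_mul_of_nonneg_left (le_trans ?_ (softplus_bregman_lower _ _)) (Nat.cast_nonneg _)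
    refine mul_le_mul_of_nonneg_left ?_ (dlink_pos _).le
    exact div_le_div_of_nonneg_left (sq_nonneg _) (by positivity) (by linarith [hg i])
  have hdiff := logLik_sub z θ₀ c y θ
  have hs := (abs_le.1 (h.abs_score_sum_le v)).2
  have hmain : q ^ 2 / (2 + x * q) ≤ B * q := by
    rw [← hv] at hdiff
    linarith
  rw [div_le_iff₀ (by positivity)] at hmain
  -- From q ≤ B(2 + xq) and xB ≤ 0.1: xq ≤ 0.2/0.9 < 0.23.
  have hxq : x * q ≤ 0.23 := by
    rcases hq0.eq_or_lt with h0 | h0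
    · rw [← h0]; norm_num
    · have h1 : q ≤ B * (2 + x * q) := by
        refine le_of_mul_le_mul_right ?_ h0
        calc q * q = q ^ 2 := by ring
          _ ≤ _ := hmain
          _ = _ := by ring
      have h2 := mul_le_mul_of_nonneg_left h1 hx0
      nlinarith [mul_le_mul_of_nonneg_right hxB (mul_nonneg hx0 hq0)]
  exact (hg i).trans hxq

lemma eq_zero_of_inner_eq_zero (h : RegularBatch z θ₀ c y b) {v : E d} (hv : ∀ i, inner ℝ (z i) v = 0) : v = 0 := by
  by_contra hne
  have := (infoMatrix_posDef_iff z _).1 h.posDef v hne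
  simp [hv] at this

/-- A regular batch has a maximum likelihood estimate. -/
lemma exists_isMLE (h : RegularBatch z θ₀ c y b) : ∃ θ, IsMLE z c y θ := by
  let L : E d →ₗ[ℝ] (ι → ℝ) := LinearMap.pi fun i => (innerSL ℝ (z i)).toLinearMap
  have hL : ∀ v i, L v i = inner ℝ (z i) v := fun v i => rfl
  have hLinj : LinearMap.ker L = ⊥ := by
    rw [LinearMap.ker_eq_bot']
    intro v hv
    exact h.eq_zero_of_inner_eq_zero fun i => by rw [← hL, hv]; rfl
  have hemb := LinearMap.isClosedEmbedding_of_injective hLinj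
  -- Positive definiteness makes θ ↦ (z_iᵀθ)_i injective, so the preimage of a box is compact; this
  -- one contains every parameter at least as likely as `θ₀`.
  let C : Set (E d) := L ⁻¹' (Set.pi Set.univ fun i =>
    Set.Icc (inner ℝ (z i) θ₀ - 0.23) (inner ℝ (z i) θ₀ + 0.23))
  have hC : IsCompact C := hemb.isCompact_preimage (isCompact_univ_pi fun i => isCompact_Icc)
  have hmem : ∀ θ, logLik z c y θ₀ ≤ logLik z c y θ → θ ∈ C := by
    intro θ hθ i _
    have := abs_le.1 (h.abs_inner_le_of_logLik_le hθ i)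
    rw [inner_sub_right] at this
    rw [hL]
    exact ⟨by linarith, by linarith⟩
  obtain ⟨θ, -, hmax⟩ := hC.exists_isMaxOn ⟨θ₀, hmem θ₀ le_rfl⟩
    (continuous_logLik (y := y)).continuousOn
  refine ⟨θ, fun θ' => ?_⟩
  rcases le_total (logLik z c y θ₀) (logLik z c y θ') with hle | hle
  · exact hmax (hmem θ' hle)
  · exact hle.trans (hmax (hmem θ₀ le_rfl))

/-- Deviation bound for the maximum likelihood estimate. -/
lemma abs_inner_sub_le (h : RegularBatch z θ₀ c y b) {θ : E d} (hθ : IsMLE z c y θ) (k : ι) :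
    |inner ℝ (z k) (θ - θ₀)| ≤ 1.07 * (b * √(invNormSq (dataInfo z θ₀ c) (z k))) := by
  set v := θ - θ₀ with hv
  set q := infoNorm z θ₀ c v with hq
  set B := √d * b with hB
  have hq0 : 0 ≤ q := infoNorm_nonneg v
  have hB0 : 0 ≤ B := mul_nonneg (Real.sqrt_nonneg _) h.nonneg
  have hb0 := h.nonneg
  have : Nonempty ι := ⟨k⟩
  have hsmall : ∀ i, |inner ℝ (z i) v| ≤ 0.23 := h.abs_inner_le_of_logLik_le (hθ θ₀)
  have hfoc : ∀ u : E d, ∑ i, c i * (Real.sigmoid (inner ℝ (z i) θ₀ + inner ℝ (z i) v) -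
      Real.sigmoid (inner ℝ (z i) θ₀)) * inner ℝ (z i) u =
      ∑ i, score z θ₀ c y i * inner ℝ (z i) u := by
    intro u
    rw [← hθ.sum_eq_zero θ₀ u]
    refine Finset.sum_congr rfl fun i _ => ?_
    rw [hv, inner_sub_right, add_sub_cancel]
  -- The first-order condition tested against v itself: curvature at least 0.87 q², since t(1 -
  -- e^(-t)) ≥ 0.87 t² for t ≤ 0.23, against noise at most Bq.
  have hqB : 0.87 * q ≤ B := by
    have h1 : 0.87 * q ^ 2 ≤ B * q := by
      refine le_trans ?_ ((le_abs_self _).trans (h.abs_score_sum_le v))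
      rw [← hfoc, hq, infoNorm_sq, Finset.mul_sum]
      refine Finset.sum_le_sum fun i _ => ?_
      have h2 := sigmoid_increment_mul_lower (inner ℝ (z i) θ₀) (inner ℝ (z i) v)
      set t := |inner ℝ (z i) v| with ht
      have ht0 : 0 ≤ t := abs_nonneg _
      have h3 : Real.exp (-t) ≤ 1 - t + 0.13 * t := by
        have h6 := Real.exp_bound (x := -t)
          (by rw [abs_neg, abs_of_nonneg ht0]; linarith [hsmall i]) (n := 3) (by norm_num)
        have h7 := (abs_le.1 h6).2
        simp [Finset.sum_range_succ, Nat.factorial, abs_of_nonneg ht0] at h7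
        norm_num at h7
        have h8 : t ^ 2 ≤ 0.23 * t := by nlinarith [hsmall i]
        have h9 : t ^ 3 ≤ 0.0529 * t := by nlinarith [hsmall i]
        linarith
      have h4 : 0.87 * t ^ 2 ≤ t * (1 - Real.exp (-t)) := by nlinarith
      have h5 : inner ℝ (z i) v ^ 2 = t ^ 2 := (sq_abs _).symm
      rw [h5]
      calc 0.87 * (c i * dlink (inner ℝ (z i) θ₀) * t ^ 2)
          = c i * (dlink (inner ℝ (z i) θ₀) * (0.87 * t ^ 2)) := by ring
        _ ≤ c i * (dlink (inner ℝ (z i) θ₀) * (t * (1 - Real.exp (-t)))) :=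
            mul_le_mul_of_nonneg_left (mul_le_mul_of_nonneg_left h4 (dlink_pos _).le)
              (Nat.cast_nonneg _)
        _ ≤ c i * _ := mul_le_mul_of_nonneg_left h2 (Nat.cast_nonneg _)
        _ = _ := by ring
    rcases hq0.eq_or_lt with h0 | h0
    · rw [← h0]; simpa using hB0
    · refine le_of_mul_le_mul_right ?_ h0
      linarith [h1, sq q]
  -- The first-order condition tested against M⁻¹z_k: z_kᵀv equals `linError` up to a second-order
  -- remainder 0.56 α √N q, and 0.56/0.87 < 0.65. Thus √d enters only through the product αB.
  have hstep : ∀ α, (∀ i, |inner ℝ (z i) v| ≤ α) → ∀ k, |inner ℝ (z k) v| ≤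
      √(invNormSq (dataInfo z θ₀ c) (z k)) * (b + 0.65 * (α * B)) := by
    intro α hα k
    have hα0 : 0 ≤ α := (abs_nonneg _).trans (hα k)
    set u := dualVec (dataInfo z θ₀ c) (z k) with hu
    set N := invNormSq (dataInfo z θ₀ c) (z k) with hN
    have hN0 : 0 ≤ N := invNormSq_nonneg h.posDef _
    have e1 : inner ℝ (z k) v = ∑ i, c i * dlink (inner ℝ (z i) θ₀) * inner ℝ (z i) u *
        inner ℝ (z i) v := (sum_inner_dualVec h.posDef (z k) v).symm
    have e2 : linError z θ₀ c y k = ∑ i, c i *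
        (Real.sigmoid (inner ℝ (z i) θ₀ + inner ℝ (z i) v) -
          Real.sigmoid (inner ℝ (z i) θ₀)) * inner ℝ (z i) u := by
      rw [hfoc, linError]
    have e3 : |inner ℝ (z k) v - linError z θ₀ c y k| ≤ 0.56 * α * (√N * q) := by
      rw [e1, e2, ← Finset.sum_sub_distrib]
      refine (Finset.abs_sum_le_sum_abs _ _).trans ?_
      have hterm : ∀ i, |c i * dlink (inner ℝ (z i) θ₀) * inner ℝ (z i) u * inner ℝ (z i) v -
          c i * (Real.sigmoid (inner ℝ (z i) θ₀ + inner ℝ (z i) v) -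
            Real.sigmoid (inner ℝ (z i) θ₀)) * inner ℝ (z i) u| ≤
          0.56 * α * (c i * dlink (inner ℝ (z i) θ₀) * |inner ℝ (z i) u| *
            |inner ℝ (z i) v|) := by
        intro i
        have h1 := abs_sigmoid_increment_sub (inner ℝ (z i) θ₀) (inner ℝ (z i) v)
        have h2 : Real.exp |inner ℝ (z i) v| - 1 - |inner ℝ (z i) v| ≤
            0.56 * α * |inner ℝ (z i) v| := by
          set t := |inner ℝ (z i) v| with ht
          have ht0 : 0 ≤ t := abs_nonneg _
          have ht1 : t ≤ 0.23 := hsmall i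
          have h6 := Real.exp_bound (x := t) (by rw [abs_of_nonneg ht0]; linarith)
            (n := 3) (by norm_num)
          have h7 := (abs_le.1 h6).2
          simp [Finset.sum_range_succ, Nat.factorial, abs_of_nonneg ht0] at h7
          norm_num at h7
          have h8 : t ^ 3 ≤ 0.23 * t ^ 2 := by nlinarith [sq_nonneg t]
          have h9 : t ^ 2 ≤ α * t := by nlinarith [hα i]
          nlinarith
        calc _ = |(c i * inner ℝ (z i) u) * (dlink (inner ℝ (z i) θ₀) * inner ℝ (z i) v -
              (Real.sigmoid (inner ℝ (z i) θ₀ + inner ℝ (z i) v) -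
                Real.sigmoid (inner ℝ (z i) θ₀)))| := by congr 1; ring
          _ = c i * |inner ℝ (z i) u| * |dlink (inner ℝ (z i) θ₀) * inner ℝ (z i) v -
              (Real.sigmoid (inner ℝ (z i) θ₀ + inner ℝ (z i) v) -
                Real.sigmoid (inner ℝ (z i) θ₀))| := by
              rw [abs_mul, abs_mul, Nat.abs_cast]
          _ ≤ c i * |inner ℝ (z i) u| * (dlink (inner ℝ (z i) θ₀) *
              (0.56 * α * |inner ℝ (z i) v|)) :=
              mul_le_mul_of_nonneg_left
                (h1.trans (mul_le_mul_of_nonneg_left h2 (dlink_pos _).le)) (by positivity)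
          _ = _ := by ring
      refine (Finset.sum_le_sum fun i _ => hterm i).trans ?_
      rw [← Finset.mul_sum]
      refine mul_le_mul_of_nonneg_left ?_ (by positivity)
      refine (abs_le_of_sq_le_sq' ?_ (by positivity)).2
      refine (sum_mul_mul_sq_le (weight_nonneg z θ₀ c) _ _).trans ?_
      simp only [sq_abs]
      rw [mul_pow, Real.sq_sqrt hN0, hq, infoNorm_sq]
      exact (congrArg (· * _) (sum_inner_dualVec_sq h.posDef (z k))).le
    have e4 := h.linError_le k
    have e5 : 0.56 * α * (√N * q) ≤ √N * (0.65 * (α * B)) := by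
      have : 0.56 * q ≤ 0.65 * B := by linarith
      calc _ = (α * √N) * (0.56 * q) := by ring
        _ ≤ (α * √N) * (0.65 * B) := mul_le_mul_of_nonneg_left this (by positivity)
        _ = _ := by ring
    have e6 : |inner ℝ (z k) v| ≤ |inner ℝ (z k) v - linError z θ₀ c y k| +
        |linError z θ₀ c y k| := by
      simpa using abs_add_le (inner ℝ (z k) v - linError z θ₀ c y k) (linError z θ₀ c y k)
    linarith [mul_comm b √N]
  -- Bootstrap at the worst arm: αB ≤ xB(b + 0.65αB) ≤ 0.1b + 0.065αB, so αB ≤ 0.107b, and 1 + 0.65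
  -- · 0.107 < 1.07.
  obtain ⟨m, hm⟩ := Finite.exists_max fun i => |inner ℝ (z i) v|
  set α := |inner ℝ (z m) v| with hα
  have hα0 : 0 ≤ α := abs_nonneg _
  set x := √(invNormSq (dataInfo z θ₀ c) (z m)) with hx
  have hx0 : 0 ≤ x := Real.sqrt_nonneg _
  have h1 : α ≤ x * (b + 0.65 * (α * B)) := hstep α hm m
  have hxB : x * B ≤ 0.1 := h.leverage m
  have h2 : α * B ≤ 0.107 * b := by
    have h3 := mul_le_mul_of_nonneg_right h1 hB0
    nlinarith [mul_le_mul_of_nonneg_right hxB hb0,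
      mul_le_mul_of_nonneg_right hxB (mul_nonneg hα0 hB0)]
  calc _ ≤ _ := hstep α hm k
    _ ≤ √(invNormSq (dataInfo z θ₀ c) (z k)) * (1.07 * b) :=
        mul_le_mul_of_nonneg_left (by linarith) (Real.sqrt_nonneg _)
    _ = _ := by ring

end RegularBatch

end MLE

/-! ### Concentration of the linearized errors -/

section Concentration

open MeasureTheory ProbabilityTheory

variable {d : ℕ} {ι : Type*} [Fintype ι] {z : ι → E d} {θ₀ : E d}
  {Ω : Type*} [MeasurableSpace Ω] {P : Measure Ω} [IsProbabilityMeasure P]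

lemma integral_comp_bool {X : Ω → Bool} (hX : Measurable X) {p : ℝ}
    (hp : P.real {a | X a = true} = p) (f : Bool → ℝ) :
    ∫ a, f (X a) ∂P = p * f true + (1 - p) * f false := by
  have hm : MeasurableSet {a | X a = true} := hX (measurableSet_singleton true)
  have hpt : (P.map X).real {true} = p := by
    rw [map_measureReal_apply hX (measurableSet_singleton _)]; exact hp
  have hpf : (P.map X).real {false} = 1 - p := by
    rw [map_measureReal_apply hX (measurableSet_singleton _), ← hp, ← probReal_compl_eq_one_sub hm]
    congr 1
    ext a; simp
  rw [← integral_map (f := f) hX.aemeasurable (by fun_prop),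
    integral_fintype (Integrable.of_finite)]
  simp [hpt, hpf]

/-- The centred label of a query. -/
def centred (x : ℝ) (b : Bool) : ℝ := (if b then 1 else 0) - Real.sigmoid x

/-- Chernoff bound for weighted sums of centred labels. -/
lemma labels_sum_tail {Y : Ω → Phase → ι → ℕ → Bool}
    (hYm : ∀ p i j, Measurable (fun a => Y a p i j))
    (hYindep : iIndepFun (fun (q : Phase × ι × ℕ) (a : Ω) => Y a q.1 q.2.1 q.2.2) P)
    (hYlaw : ∀ p i j, P.real {a | Y a p i j = true} = Real.sigmoid (inner ℝ (z i) θ₀))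
    (p : Phase) (c : ι → ℕ) (r : ι → ℝ) {t : ℝ} (ht : 0 ≤ t) (hr : ∀ i, |t * r i| ≤ 0.1) (u : ℝ) :
    P.real {a | u ≤ ∑ i, score z θ₀ c (labels (Y a) p c) i * r i} ≤
      Real.exp (-t * u + 0.53 * (t ^ 2 * ∑ i, c i * dlink (inner ℝ (z i) θ₀) * r i ^ 2)) := by
  let X : (Σ i, Fin (c i)) → Ω → ℝ := fun q a =>
    centred (inner ℝ (z q.1) θ₀) (Y a p q.1 q.2) * r q.1
  have hXm : ∀ q, Measurable (X q) := fun q =>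
    (measurable_from_top (f := fun b => centred (inner ℝ (z q.1) θ₀) b * r q.1)).comp
      (hYm p q.1 q.2)
  have hXi : iIndepFun X P := by
    have h1 := hYindep.precomp (g := fun q : Σ i, Fin (c i) => (p, q.1, (q.2 : ℕ))) (by
      rintro ⟨i, j⟩ ⟨i', j'⟩ h
      simp only [Prod.mk.injEq, true_and] at h
      obtain ⟨rfl, h⟩ := h
      rw [Fin.ext h])
    exact h1.comp (fun q b => centred (inner ℝ (z q.1) θ₀) b * r q.1) fun q => measurable_from_top
  have hsum : ∀ a, ∑ i, score z θ₀ c (labels (Y a) p c) i * r i = (∑ q, X q) a := by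
    intro a
    rw [Finset.sum_apply, Fintype.sum_sigma]
    refine Finset.sum_congr rfl fun i _ => ?_
    rw [score, Finset.sum_mul]
    rfl
  have hmgf : ∀ q, mgf (X q) P t ≤
      Real.exp (0.53 * (t ^ 2 * (dlink (inner ℝ (z q.1) θ₀) * r q.1 ^ 2))) := by
    intro q
    have h1 := integral_comp_bool (hYm p q.1 q.2) (hYlaw p q.1 q.2)
      (fun b => Real.exp (t * (centred (inner ℝ (z q.1) θ₀) b * r q.1)))
    have h2 := bernoulli_mgf_le (Real.sigmoid_nonneg (inner ℝ (z q.1) θ₀)) (Real.sigmoid_le_one _)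
      (hr q.1)
    calc mgf (X q) P t = _ := h1
      _ = _ := by
          simp only [centred, if_true, Bool.false_eq_true, if_false]
          congr 3 <;> ring
      _ ≤ _ := h2
      _ = _ := by rw [dlink_eq]; congr 1; ring
  have hbdd : ∀ q a, |X q a| ≤ |r q.1| := by
    intro q a
    simp only [X]
    rw [abs_mul]
    refine mul_le_of_le_one_left (abs_nonneg _) ?_
    have h0 := Real.sigmoid_nonneg (inner ℝ (z q.1) θ₀)
    have h1 := Real.sigmoid_le_one (inner ℝ (z q.1) θ₀)
    rw [centred, abs_le]
    split_ifs <;> constructor <;> linarith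
  have hSm : Measurable (∑ q, X q) := by
    rw [Finset.sum_fn]
    exact Finset.measurable_sum _ fun q _ => hXm q
  have hint : Integrable (fun a => Real.exp (t * (∑ q, X q) a)) P := by
    refine Integrable.of_bound (C := Real.exp (t * ∑ q : Σ i, Fin (c i), |r q.1|))
      (by fun_prop) (Filter.Eventually.of_forall fun a => ?_)
    rw [Real.norm_eq_abs, Real.abs_exp, Real.exp_le_exp]
    refine mul_le_mul_of_nonneg_left ?_ ht
    rw [Finset.sum_apply]
    exact Finset.sum_le_sum fun q _ => (le_abs_self _).trans (hbdd q a)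
  have hch := measure_ge_le_exp_mul_mgf u ht hint
  simp only [hsum]
  refine hch.trans ?_
  rw [hXi.mgf_sum hXm, Real.exp_add]
  refine mul_le_mul_of_nonneg_left ?_ (Real.exp_pos _).le
  calc ∏ q, mgf (X q) P t ≤ ∏ q : Σ i, Fin (c i),
        Real.exp (0.53 * (t ^ 2 * (dlink (inner ℝ (z q.1) θ₀) * r q.1 ^ 2))) :=
        Finset.prod_le_prod (fun q _ => mgf_nonneg) fun q _ => hmgf q
    _ = _ := by
        rw [← Real.exp_sum, Fintype.sum_sigma]
        simp only [Finset.sum_const, Finset.card_univ, Fintype.card_fin, nsmul_eq_mul,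
          Finset.mul_sum]
        congr 1
        exact Finset.sum_congr rfl fun i _ => by ring

/-- Chernoff with t = b/√N at level b√N: the exponent is -b² + 0.53b² = -0.47b². The leverage
condition keeps t z_iᵀM⁻¹z_k within 0.1, where the quadratic bound on the moment generating function
holds. The factor 2K counts signs and arms. -/
lemma linError_tail {Y : Ω → Phase → ι → ℕ → Bool}
    (hYm : ∀ p i j, Measurable (fun a => Y a p i j))
    (hYindep : iIndepFun (fun (q : Phase × ι × ℕ) (a : Ω) => Y a q.1 q.2.1 q.2.2) P)
    (hYlaw : ∀ p i j, P.real {a | Y a p i j = true} = Real.sigmoid (inner ℝ (z i) θ₀))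
    (p : Phase) (c : ι → ℕ) {b : ℝ} (hb : 0 ≤ b) (hz : ∀ i, z i ≠ 0)
    (hP : (dataInfo z θ₀ c).PosDef)
    (hlev : ∀ i, √(invNormSq (dataInfo z θ₀ c) (z i)) * b ≤ 0.1) :
    P.real {a | ∃ k, b * √(invNormSq (dataInfo z θ₀ c) (z k)) <
        |linError z θ₀ c (labels (Y a) p c) k|} ≤
      2 * Fintype.card ι * Real.exp (-(0.47 * b ^ 2)) := by
  have key : ∀ k, P.real {a | b * √(invNormSq (dataInfo z θ₀ c) (z k)) <
      |linError z θ₀ c (labels (Y a) p c) k|} ≤ 2 * Real.exp (-(0.47 * b ^ 2)) := by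
    intro k
    set N := invNormSq (dataInfo z θ₀ c) (z k) with hN
    have hN0 : 0 < N := invNormSq_pos hP (hz k)
    have hs0 : 0 < √N := Real.sqrt_pos.2 hN0
    set u := dualVec (dataInfo z θ₀ c) (z k) with hu
    have hvar : ∑ i, c i * dlink (inner ℝ (z i) θ₀) * inner ℝ (z i) u ^ 2 = N :=
      sum_inner_dualVec_sq hP (z k)
    have hr : ∀ i, |b / √N * inner ℝ (z i) u| ≤ 0.1 := by
      intro i
      have h1 : |inner ℝ (z i) u| ≤ √(invNormSq (dataInfo z θ₀ c) (z i)) * √N := by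
        rw [← Real.sqrt_mul (invNormSq_nonneg hP _)]
        exact Real.abs_le_sqrt (inner_dualVec_sq_le (weight_nonneg z θ₀ c) hP _ _)
      rw [abs_mul, abs_of_nonneg (by positivity)]
      calc b / √N * |inner ℝ (z i) u| ≤ b / √N * (√(invNormSq (dataInfo z θ₀ c) (z i)) * √N) :=
            mul_le_mul_of_nonneg_left h1 (by positivity)
        _ = √(invNormSq (dataInfo z θ₀ c) (z i)) * b := by field_simp
        _ ≤ 0.1 := hlev i
    have hexp : -(b / √N) * (b * √N) + 0.53 * ((b / √N) ^ 2 * N) = -(0.47 * b ^ 2) := by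
      have h1 : -(b / √N) * (b * √N) = -b ^ 2 := by field_simp
      have h2 : (b / √N) ^ 2 * N = b ^ 2 := by
        rw [div_pow, Real.sq_sqrt hN0.le]; field_simp
      rw [h1, h2]; ring
    have hup := labels_sum_tail (z := z) (θ₀ := θ₀) hYm hYindep hYlaw p c
      (fun i => inner ℝ (z i) u) (t := b / √N) (by positivity) hr (b * √N)
    have hlo := labels_sum_tail (z := z) (θ₀ := θ₀) hYm hYindep hYlaw p c
      (fun i => -inner ℝ (z i) u) (t := b / √N) (by positivity)
      (fun i => by rw [mul_neg, abs_neg]; exact hr i) (b * √N)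
    simp only [neg_sq, mul_neg, Finset.sum_neg_distrib] at hlo
    rw [hvar] at hup hlo
    rw [hexp] at hup
    rw [hexp] at hlo
    rw [two_mul]
    refine le_trans (measureReal_mono ?_) ((measureReal_union_le _ _).trans (add_le_add hup hlo))
    intro a ha
    rcases lt_abs.1 (Set.mem_ofPred_eq ▸ ha) with h | h
    · exact Or.inl h.le
    · exact Or.inr h.le
  have hset : {a | ∃ k, b * √(invNormSq (dataInfo z θ₀ c) (z k)) <
        |linError z θ₀ c (labels (Y a) p c) k|} =
      ⋃ k, {a | b * √(invNormSq (dataInfo z θ₀ c) (z k)) <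
        |linError z θ₀ c (labels (Y a) p c) k|} := by ext; simp
  rw [hset]
  refine (measureReal_iUnion_fintype_le _).trans ((Finset.sum_le_sum fun k _ => key k).trans ?_)
  rw [Finset.sum_const, Finset.card_univ, nsmul_eq_mul]
  linarith

end Concentration

/-! ### Information collected by the algorithm -/

section Rounds

variable {d : ℕ} {ι : Type*} [Fintype ι]

/-- The logarithmic factor in the number of queries of round `l`. -/
def logTerm (ι : Type*) [Fintype ι] (δ : ℝ) (l : ℕ) : ℝ :=
  Real.log (2 * (l : ℝ) ^ 2 * Fintype.card ι * (2 + Fintype.card ι) / δ)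

lemma log_six_ge : (1.75 : ℝ) ≤ Real.log 6 := by
  rw [Real.le_log_iff_exp_le (by norm_num)]
  have h1 : Real.exp 1.75 ^ 4 = Real.exp 1 ^ 7 := by
    rw [← Real.exp_nat_mul, ← Real.exp_nat_mul]; norm_num
  have h2 : Real.exp 1 ^ 7 ≤ 6 ^ 4 :=
    (pow_le_pow_left₀ (Real.exp_pos 1).le Real.exp_one_lt_d9.le 7).trans (by norm_num)
  exact le_of_pow_le_pow_left₀ (n := 4) (by norm_num) (by norm_num) (h1 ▸ h2)

lemma six_le_logTerm_arg [Nonempty ι] {δ : ℝ} (hδ : 0 < δ) (hδ1 : δ < 1) {l : ℕ} (hl : 1 ≤ l) :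
    6 ≤ 2 * (l : ℝ) ^ 2 * Fintype.card ι * (2 + Fintype.card ι) / δ := by
  have hK : (1 : ℝ) ≤ Fintype.card ι := by exact_mod_cast Fintype.card_pos
  have hl' : (1 : ℝ) ≤ (l : ℝ) ^ 2 := one_le_pow₀ (by exact_mod_cast hl)
  rw [le_div_iff₀ hδ]
  have h1 : (1 : ℝ) ≤ (l : ℝ) ^ 2 * Fintype.card ι := one_le_mul_of_one_le_of_one_le hl' hK
  nlinarith

lemma log_six_le_logTerm [Nonempty ι] {δ : ℝ} (hδ : 0 < δ) (hδ1 : δ < 1) {l : ℕ} (hl : 1 ≤ l) :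
    Real.log 6 ≤ logTerm ι δ l :=
  Real.log_le_log (by norm_num) (six_le_logTerm_arg hδ hδ1 hl)

lemma logTerm_ge [Nonempty ι] {δ : ℝ} (hδ : 0 < δ) (hδ1 : δ < 1) {l : ℕ} (hl : 1 ≤ l) :
    1.75 ≤ logTerm ι δ l :=
  log_six_ge.trans (log_six_le_logTerm hδ hδ1 hl)

lemma logTerm_one_le [Nonempty ι] {δ : ℝ} (hδ : 0 < δ) (hδ1 : δ < 1) {l : ℕ} (hl : 1 ≤ l) :
    logTerm ι δ 1 ≤ logTerm ι δ l := by
  have h6 := six_le_logTerm_arg (ι := ι) hδ hδ1 le_rfl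
  refine Real.log_le_log (by linarith) ?_
  have hl' : (1 : ℝ) ≤ l := by exact_mod_cast hl
  rw [Nat.cast_one]
  gcongr

/-- 64 log 6 ≥ 64 · 1.75 = 112, and the other logarithm is nonnegative. -/
lemma gam_ge [Nonempty ι] {δ : ℝ} (hδ : 0 < δ) (hδ1 : δ < 1) : 112 * (d : ℝ) ≤ gam ι d δ := by
  have h1 : 0 ≤ Real.log ((2 + Fintype.card ι) / δ) := by
    refine Real.log_nonneg ?_
    rw [le_div_iff₀ hδ]
    have : (0 : ℝ) ≤ Fintype.card ι := Nat.cast_nonneg _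
    linarith
  have h2 := mul_le_mul_of_nonneg_left log_six_ge (Nat.cast_nonneg (α := ℝ) d)
  rw [gam]
  linarith

/-- The batch with `c i` pulls of arm `i` is informative enough for round `l`. -/
structure GoodCounts (z : ι → E d) (θ₀ : E d) (δ : ℝ) (l : ℕ) (c : ι → ℕ) : Prop where
  posDef : (dataInfo z θ₀ c).PosDef
  leverage : ∀ i, 2.5 * gam ι d δ * logTerm ι δ l * invNormSq (dataInfo z θ₀ c) (z i) ≤ 1

/-- Confidence radius of round `l`. -/
def radius (ι : Type*) [Fintype ι] (δ : ℝ) (l : ℕ) : ℝ := √(2.75 * logTerm ι δ l)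

lemma radius_sq [Nonempty ι] {δ : ℝ} (hδ : 0 < δ) (hδ1 : δ < 1) {l : ℕ} (hl : 1 ≤ l) :
    radius ι δ l ^ 2 = 2.75 * logTerm ι δ l :=
  Real.sq_sqrt (by linarith [logTerm_ge (ι := ι) hδ hδ1 hl])

lemma radius_nonneg (ι : Type*) [Fintype ι] (δ : ℝ) (l : ℕ) : 0 ≤ radius ι δ l :=
  Real.sqrt_nonneg _

/-- Squared, the left side is at most 2.75/(2.5 · 112) < 0.01, because γ ≥ 112 d absorbs the factor
d. -/
lemma GoodCounts.leverage_radius [Nonempty ι] {z : ι → E d} {θ₀ : E d} {δ : ℝ} {l : ℕ}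
    {c : ι → ℕ} (h : GoodCounts z θ₀ δ l c) (hd : 1 ≤ d) (hδ : 0 < δ) (hδ1 : δ < 1) (hl : 1 ≤ l)
    (i : ι) :
    √(invNormSq (dataInfo z θ₀ c) (z i)) * (√d * radius ι δ l) ≤ 0.1 := by
  have hN := invNormSq_nonneg h.posDef (z i)
  have hL := logTerm_ge (ι := ι) hδ hδ1 hl
  have hγ := gam_ge (ι := ι) (d := d) hδ hδ1
  have hd' : (1 : ℝ) ≤ d := by exact_mod_cast hd
  refine abs_le_of_sq_le_sq' ?_ (by norm_num) |>.2
  rw [mul_pow, mul_pow, Real.sq_sqrt hN, Real.sq_sqrt (by positivity), radius_sq hδ hδ1 hl]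
  have h1 := h.leverage i
  have h2 : 2.5 * (112 * (d : ℝ)) * (logTerm ι δ l * invNormSq (dataInfo z θ₀ c) (z i)) ≤ 1 := by
    refine le_trans ?_ h1
    rw [mul_assoc (2.5 * gam ι d δ)]
    have : 0 ≤ logTerm ι δ l * invNormSq (dataInfo z θ₀ c) (z i) :=
      mul_nonneg (by linarith) hN
    exact mul_le_mul_of_nonneg_right (by linarith) this
  nlinarith

/-- A sparse support has at most 2d² points, less than 5% of 588d² pulls. The threshold 588 = 3 ·
112 · 1.75 is what the query numbers guarantee. -/
lemma IsRounding.lower_of_sparse {lam : ι → ℝ} (hlam : lam ∈ stdSimplex ℝ ι)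
    (hcard : (Function.support lam).ncard ≤ d * (d + 1) / 2 + 1) (hd : 1 ≤ d) {n : ℕ} {c : ι → ℕ}
    (hc : IsRounding lam n c) (hn : 588 * (d : ℝ) ^ 2 ≤ n) (i : ι) :
    0.95 * n * lam i ≤ c i := by
  refine le_trans (mul_le_mul_of_nonneg_right ?_ (hlam.1 i)) (hc.mul_le hlam i)
  have h1 : (Function.support lam).ncard ≤ 2 * d ^ 2 := by
    have h2 : d * (d + 1) / 2 ≤ d ^ 2 := by
      apply Nat.div_le_of_le_mul; nlinarith
    nlinarith
  have h2 : ((Function.support lam).ncard : ℝ) ≤ 2 * (d : ℝ) ^ 2 := by exact_mod_cast h1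
  nlinarith

/-- The Kiefer-Wolfowitz bound makes the G-optimal value at most d, and κ₀ converts the unweighted
matrix into Fisher information at `θ₀`. After rounding, the constant 0.95 · 3 = 2.85 exceeds 2.5. -/
lemma warmCounts_good [Nonempty ι] {z : ι → E d} (hspan : Submodule.span ℝ (Set.range z) = ⊤)
    (hd : 1 ≤ d) {θ₀ : E d} {δ ω κ₀ : ℝ} (hδ : 0 < δ) (hδ1 : δ < 1) (hω : 0 < ω) (hκ₀ : 0 < κ₀)
    (hκ : ∀ i, κ₀ ≤ dlink (inner ℝ (z i) θ₀)) (S : Solver z δ) :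
    GoodCounts z θ₀ δ 1 (warmCounts S ω κ₀) := by
  obtain ⟨⟨hlam, hlamP⟩, hopt, hcard⟩ :=
    S.warmDesign_spec (exists_isOptimalDesign_gObjective hspan)
  set lam := S.warmDesign
  set n := warmN ι d δ ω κ₀ with hn
  have hround : IsRounding lam n (warmCounts S ω κ₀) :=
    S.round_spec lam n (exists_isRounding hlam n)
  set c := warmCounts S ω κ₀
  have hL := logTerm_ge (ι := ι) hδ hδ1 le_rfl
  have hγ := gam_ge (ι := ι) (d := d) hδ hδ1
  have hd' : (1 : ℝ) ≤ d := by exact_mod_cast hd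
  set L := logTerm ι δ 1 with hLdef
  set γ := gam ι d δ
  have hγ0 : 0 < γ := by linarith
  have hL0 : 0 < L := by linarith
  have hnle : 3 * κ₀⁻¹ * (d * γ * L) ≤ n := by
    have h1 : 3 * (1 + ω) * κ₀⁻¹ * d * γ *
        Real.log (2 * Fintype.card ι * (2 + Fintype.card ι) / δ) ≤ n := Nat.le_ceil _
    have h2 : Real.log (2 * Fintype.card ι * (2 + Fintype.card ι) / δ) = L := by
      simp [hLdef, logTerm]
    rw [h2] at h1
    refine le_trans ?_ h1
    have h3 : 0 ≤ 3 * κ₀⁻¹ * (d * γ * L) := by positivity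
    nlinarith
  have hdγL : 196 * (d : ℝ) ^ 2 ≤ d * γ * L := by
    calc 196 * (d : ℝ) ^ 2 = d * (112 * d) * 1.75 := by ring
      _ ≤ d * γ * L := by gcongr
  have hκ1 : 1 ≤ κ₀⁻¹ := by
    rw [one_le_inv₀ hκ₀]
    exact (hκ (Classical.arbitrary ι)).trans (dlink_le_one _)
  have hn588 : 588 * (d : ℝ) ^ 2 ≤ n := by nlinarith
  have hc := fun i => hround.lower_of_sparse hlam hcard hd hn588 i
  have hww : ∀ i, (2.5 * (d * γ * L)) * lam i ≤ c i * dlink (inner ℝ (z i) θ₀) := by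
    intro i
    have h1 : 0.95 * (3 * κ₀⁻¹ * (d * γ * L)) * lam i ≤ c i :=
      le_trans (mul_le_mul_of_nonneg_right (by linarith) (hlam.1 i)) (hc i)
    have h2 := mul_le_mul h1 (hκ i) hκ₀.le (Nat.cast_nonneg _)
    refine le_trans ?_ h2
    have h3 : 0.95 * (3 * κ₀⁻¹ * (d * γ * L)) * lam i * κ₀ = 2.85 * (d * γ * L) * lam i := by
      field_simp; ring
    rw [h3]
    exact mul_le_mul_of_nonneg_right (by nlinarith) (hlam.1 i)
  have ht : 0 < 2.5 * (d * γ * L) := by positivity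
  obtain ⟨lam', hlam', hlamP', hle⟩ := exists_design_invNormSq_le hspan
  have hN : ∀ i, invNormSq (infoMatrix z lam) (z i) ≤ d := fun i =>
    (le_ciSup (f := fun i => invNormSq (infoMatrix z lam) (z i))
      (Set.finite_range _).bddAbove i).trans ((hopt lam' hlam' hlamP').trans (ciSup_le hle))
  refine ⟨infoMatrix_posDef_mono ht hlamP hww, fun i => ?_⟩
  have h1 := (mul_invNormSq_le ht hlam.1 hlamP hww (z i)).trans (hN i)
  refine le_of_mul_le_mul_left ?_ (show (0 : ℝ) < d by linarith)
  calc _ = 2.5 * (d * γ * L) * invNormSq (dataInfo z θ₀ c) (z i) := by ring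
    _ ≤ d := h1
    _ = d * 1 := (mul_one _).symm

lemma eps_pos (l : ℕ) : 0 < eps l := zpow_pos two_pos _

/-- The design refers to the previous estimate, the information to `θ₀`: this costs a factor e^0.107
≤ 1.12, and rounding costs 0.95, leaving 3 · 0.95/1.12 > 2.5. The number of queries is proportional
to f, so f cancels, and the two terms of the objective become the two conclusions. -/
lemma roundCounts_good [Nonempty ι] {z : ι → E d} (hspan : Submodule.span ℝ (Set.range z) = ⊤)
    (hd : 1 ≤ d) {θ₀ : E d} {δ ω : ℝ} (hδ : 0 < δ) (hδ1 : δ < 1) (hω : 0 < ω)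
    (S : Solver z δ) {l : ℕ} (hl : 1 ≤ l) (s : State d ι)
    (hs : ∀ i, |inner ℝ (z i) (s.est - θ₀)| ≤ 0.107) :
    GoodCounts z θ₀ δ l (roundCounts S ω l s) ∧ ∀ i ∈ s.active,
      2.5 * 2.4 ^ 2 * logTerm ι δ l *
        invNormSq (dataInfo z θ₀ (roundCounts S ω l s)) (z i) ≤ eps l ^ 2 := by
  have hL := logTerm_ge (ι := ι) hδ hδ1 hl
  have hγ := gam_ge (ι := ι) (d := d) hδ hδ1
  have hd' : (1 : ℝ) ≤ d := by exact_mod_cast hd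
  set L := logTerm ι δ l with hLdef
  set γ := gam ι d δ with hγdef
  have hγ0 : 0 < γ := by linarith
  have hL0 : 0 < L := by linarith
  obtain ⟨⟨hlam, hlamP⟩, -, hcard⟩ :=
    S.design_spec l s.active s.est (exists_isOptimalDesign_objective hspan hγ0 l s.active s.est)
  set lam := S.design l s.active s.est with hlamdef
  set n := roundN S ω l s with hn
  have hround : IsRounding lam n (roundCounts S ω l s) :=
    S.round_spec lam n (exists_isRounding hlam n)
  set c := roundCounts S ω l s
  set f := objective z δ l s.active s.est lam with hf
  set N' : ι → ℝ := fun i => invNormSq (fisher z lam s.est) (z i) with hN'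
  have hw0 : ∀ i, 0 ≤ lam i * dlink (inner ℝ (z i) s.est) :=
    fun i => mul_nonneg (hlam.1 i) (dlink_pos _).le
  have hsup : ∀ i, N' i ≤ ⨆ i, N' i := fun i => le_ciSup (Set.finite_range _).bddAbove i
  have hf1 : γ * (⨆ i, N' i) ≤ f := le_max_left _ _
  have hf1i : ∀ i, γ * N' i ≤ f := fun i =>
    (mul_le_mul_of_nonneg_left (hsup i) hγ0.le).trans hf1
  have hf2i : ∀ i ∈ s.active, 2.4 ^ 2 * (eps l ^ 2)⁻¹ * N' i ≤ f := by
    intro i hi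
    refine le_trans (mul_le_mul_of_nonneg_left ?_ ?_) (le_max_right _ _)
    · exact le_ciSup (f := fun i : {i // i ∈ s.active} => N' i) (Set.finite_range _).bddAbove ⟨i, hi⟩
    · have := eps_pos l; positivity
  -- By the trace identity and μ' ≤ 1, the weighted average d is at most the supremum. So f ≥ γd ≥
  -- 112d², and the batch is long enough for rounding.
  have hdsup : (d : ℝ) ≤ ⨆ i, N' i := by
    have hsup0 : 0 ≤ ⨆ i, N' i :=
      (invNormSq_nonneg hlamP _).trans (hsup (Classical.arbitrary ι))
    calc (d : ℝ) = ∑ i, lam i * dlink (inner ℝ (z i) s.est) * N' i :=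
          (sum_mul_invNormSq hlamP).symm
      _ ≤ ∑ i, lam i * ⨆ i, N' i := by
          refine Finset.sum_le_sum fun i _ => ?_
          have h1 : lam i * dlink (inner ℝ (z i) s.est) ≤ lam i :=
            mul_le_of_le_one_right (hlam.1 i) (dlink_le_one _)
          exact mul_le_mul h1 (hsup i) (invNormSq_nonneg hlamP _) (hlam.1 i)
      _ = ⨆ i, N' i := by rw [← Finset.sum_mul, hlam.2, one_mul]
  have hfd : 112 * (d : ℝ) ^ 2 ≤ f := by
    calc 112 * (d : ℝ) ^ 2 = 112 * d * d := by ring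
      _ ≤ γ * ⨆ i, N' i := mul_le_mul hγ hdsup (by positivity) hγ0.le
      _ ≤ f := hf1
  have hf0 : 0 < f := by nlinarith
  have hnle : 3 * (f * L) ≤ n := by
    have h1 : 3 * (1 + ω) * f * L ≤ n :=
      (Nat.le_ceil _).trans (by exact_mod_cast le_max_left _ _)
    refine le_trans ?_ h1
    have h3 : 0 ≤ f * L := by positivity
    nlinarith
  have hfL : 196 * (d : ℝ) ^ 2 ≤ f * L := by
    calc 196 * (d : ℝ) ^ 2 = 112 * d ^ 2 * 1.75 := by ring
      _ ≤ f * L := by gcongr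
  have hc := fun i => hround.lower_of_sparse hlam hcard hd (by linarith) i
  have hexp : Real.exp 0.107 ≤ 1.12 := by
    have h1 := Real.exp_bound (x := 0.107) (by norm_num) (n := 2) (by norm_num)
    have h2 := (abs_le.1 h1).2
    simp [Finset.sum_range_succ, Nat.factorial] at h2
    norm_num at h2
    linarith
  have hratio : ∀ i, dlink (inner ℝ (z i) s.est) ≤ 1.12 * dlink (inner ℝ (z i) θ₀) := by
    intro i
    have h1 := dlink_le_exp_mul (inner ℝ (z i) s.est) (-inner ℝ (z i) (s.est - θ₀))
    rw [abs_neg] at h1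
    have h2 : inner ℝ (z i) s.est + -inner ℝ (z i) (s.est - θ₀) = inner ℝ (z i) θ₀ := by
      rw [inner_sub_right]; ring
    rw [h2] at h1
    refine h1.trans (mul_le_mul_of_nonneg_right ?_ (dlink_pos _).le)
    exact (Real.exp_le_exp.2 (hs i)).trans hexp
  have hww : ∀ i, (2.5 * (f * L)) * (lam i * dlink (inner ℝ (z i) s.est)) ≤
      c i * dlink (inner ℝ (z i) θ₀) := by
    intro i
    have h1 : 2.85 * (f * L) * lam i ≤ c i :=
      le_trans (mul_le_mul_of_nonneg_right (by linarith) (hlam.1 i)) (hc i)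
    have hlam0 := hlam.1 i
    calc _ ≤ (2.5 * (f * L)) * (lam i * (1.12 * dlink (inner ℝ (z i) θ₀))) := by
          gcongr; exact hratio i
      _ = 2.8 * (f * L) * lam i * dlink (inner ℝ (z i) θ₀) := by ring
      _ ≤ 2.85 * (f * L) * lam i * dlink (inner ℝ (z i) θ₀) := by
          have := dlink_pos (inner ℝ (z i) θ₀)
          gcongr; norm_num
      _ ≤ _ := mul_le_mul_of_nonneg_right h1 (dlink_pos _).le
  have ht : 0 < 2.5 * (f * L) := by positivity
  have hN : ∀ i, 2.5 * (f * L) * invNormSq (dataInfo z θ₀ c) (z i) ≤ N' i :=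
    fun i => mul_invNormSq_le ht hw0 hlamP hww (z i)
  refine ⟨⟨infoMatrix_posDef_mono ht hlamP hww, fun i => ?_⟩, fun i hi => ?_⟩
  · refine le_of_mul_le_mul_left ?_ hf0
    calc _ = γ * (2.5 * (f * L) * invNormSq (dataInfo z θ₀ c) (z i)) := by ring
      _ ≤ γ * N' i := mul_le_mul_of_nonneg_left (hN i) hγ0.le
      _ ≤ f := hf1i i
      _ = f * 1 := (mul_one _).symm
  · have he := eps_pos l
    have h1 : 2.4 ^ 2 * N' i ≤ f * eps l ^ 2 := by
      have := hf2i i hi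
      rw [mul_right_comm, ← div_eq_mul_inv, div_le_iff₀ (by positivity)] at this
      exact this
    refine le_of_mul_le_mul_left ?_ hf0
    calc _ = 2.4 ^ 2 * (2.5 * (f * L) * invNormSq (dataInfo z θ₀ c) (z i)) := by ring
      _ ≤ 2.4 ^ 2 * N' i := mul_le_mul_of_nonneg_left (hN i) (by norm_num)
      _ ≤ _ := h1

end Rounds

/-! ### Runs of the algorithm without exceptional batches -/

section Runs

variable {d : ℕ} {ι : Type*} [Fintype ι]

/-- An informative batch in which some linearized error exceeds its confidence width. -/
def BadBatch (z : ι → E d) (θ₀ : E d) (δ : ℝ) (l : ℕ) (c : ι → ℕ)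
    (y : (i : ι) → Fin (c i) → Bool) : Prop :=
  GoodCounts z θ₀ δ l c ∧
    ∃ k, radius ι δ l * √(invNormSq (dataInfo z θ₀ c) (z k)) < |linError z θ₀ c y k|

section Batch

variable {z : ι → E d} {θ₀ : E d} {δ : ℝ} {l : ℕ} {c : ι → ℕ}
  {y : (i : ι) → Fin (c i) → Bool}

lemma GoodCounts.regularBatch [Nonempty ι] (h : GoodCounts z θ₀ δ l c) (hbad : ¬ BadBatch z θ₀ δ l c y)
    (hd : 1 ≤ d) (hδ : 0 < δ) (hδ1 : δ < 1) (hl : 1 ≤ l) :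
    RegularBatch z θ₀ c y (radius ι δ l) where
  posDef := h.posDef
  nonneg := radius_nonneg ι δ l
  leverage := h.leverage_radius hd hδ hδ1 hl
  linError_le k := by
    by_contra hk
    exact hbad ⟨h, k, not_le.1 hk⟩

/-- The constant is 1.07 · 0.1, as √d ≥ 1. -/
lemma RegularBatch.abs_inner_sub_le_const {b : ℝ} (h : RegularBatch z θ₀ c y b) (hd : 1 ≤ d)
    {θ : E d} (hθ : IsMLE z c y θ) (i : ι) : |inner ℝ (z i) (θ - θ₀)| ≤ 0.107 := by
  have h1 := h.abs_inner_sub_le hθ i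
  have h2 := h.leverage i
  have h3 : (1 : ℝ) ≤ √d := Real.one_le_sqrt.2 (by exact_mod_cast hd)
  have h4 : 0 ≤ b * √(invNormSq (dataInfo z θ₀ c) (z i)) := mul_nonneg h.nonneg (Real.sqrt_nonneg _)
  nlinarith

/-- Numerically 1.07² · 2.75/(2.5 · 2.4²) < 0.49². -/
lemma RegularBatch.abs_inner_sub_le_of_invNormSq_le [Nonempty ι]
    (h : RegularBatch z θ₀ c y (radius ι δ l)) (hδ : 0 < δ) (hδ1 : δ < 1) (hl : 1 ≤ l) {θ : E d} (hθ : IsMLE z c y θ) {i : ι} {ε : ℝ}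
    (hε : 0 ≤ ε)
    (hN : 2.5 * 2.4 ^ 2 * logTerm ι δ l * invNormSq (dataInfo z θ₀ c) (z i) ≤ ε ^ 2) :
    |inner ℝ (z i) (θ - θ₀)| ≤ 0.49 * ε := by
  refine (h.abs_inner_sub_le hθ i).trans (abs_le_of_sq_le_sq' ?_ (by positivity)).2
  rw [mul_pow, mul_pow, radius_sq hδ hδ1 hl, Real.sq_sqrt (invNormSq_nonneg h.posDef _)]
  nlinarith

end Batch

variable {z : ι → E d} {δ ω κ₀ : ℝ} {S : Solver z δ} {y : Phase → ι → ℕ → Bool}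

lemma state_active_succ (k : ℕ) (i : ι) :
    i ∈ (state S ω κ₀ y (k + 1)).active ↔ i ∈ (state S ω κ₀ y k).active ∧
      |inner ℝ (z i) (state S ω κ₀ y (k + 1)).est| ≤ eps (k + 1) := by
  rw [← not_lt]
  simp only [state, Finset.mem_filter]

lemma state_pulled_succ (k : ℕ) : (state S ω κ₀ y (k + 1)).pulled =
    (state S ω κ₀ y k).pulled + roundCounts S ω (k + 1) (state S ω κ₀ y k) := rfl

lemma roundCounts_le_pulled {k T : ℕ} (hk : k < T) (i : ι) :
    roundCounts S ω (k + 1) (state S ω κ₀ y k) i ≤ (state S ω κ₀ y T).pulled i := by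
  induction T, hk using Nat.le_induction with
  | base => rw [state_pulled_succ]; exact Nat.le_add_left _ _
  | succ T _ ih => rw [state_pulled_succ]; exact ih.trans (Nat.le_add_right _ _)

lemma exists_eliminated {T : ℕ} (hT : (state S ω κ₀ y T).active = ∅) (i : ι) :
    ∃ k < T, i ∈ (state S ω κ₀ y k).active ∧ i ∉ (state S ω κ₀ y (k + 1)).active := by
  by_contra hcon
  push Not at hcon
  have hall : ∀ k ≤ T, i ∈ (state S ω κ₀ y k).active := by
    intro k hk
    induction k with
    | zero => simp [state]
    | succ k ih => exact hcon k (by omega) (ih (by omega))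
  simpa [hT] using hall T le_rfl

lemma eps_succ (k : ℕ) : eps (k + 1) = (1 / 2) ^ k := by
  simp [eps, zpow_neg]

lemma sign_eq_of_abs_sub_lt {a b : ℝ} (h : |a - b| < |b|) : SignType.sign a = SignType.sign b := by
  rcases lt_trichotomy b 0 with hb | hb | hb
  · rw [abs_of_neg hb] at h
    rw [sign_neg hb, sign_neg (by linarith [(abs_lt.1 h).2])]
  · simp [hb] at h
    exact absurd h (not_lt.2 (abs_nonneg _))
  · rw [abs_of_pos hb] at h
    rw [sign_pos hb, sign_pos (by linarith [(abs_lt.1 h).1])]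

/-- Loewner monotonicity with t = 1; it makes the replay of Q at least as informative as each round
in it. -/
lemma dataInfo_mono {θ₀ : E d} {c c' : ι → ℕ} (hP : (dataInfo z θ₀ c).PosDef)
    (hcc : ∀ i, c i ≤ c' i) :
    (dataInfo z θ₀ c').PosDef ∧
      ∀ x, invNormSq (dataInfo z θ₀ c') x ≤ invNormSq (dataInfo z θ₀ c) x := by
  have hww : ∀ i, 1 * ((c i : ℝ) * dlink (inner ℝ (z i) θ₀)) ≤
      (c' i : ℝ) * dlink (inner ℝ (z i) θ₀) := fun i => by
    rw [one_mul]
    exact mul_le_mul_of_nonneg_right (by exact_mod_cast hcc i) (dlink_pos _).le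
  refine ⟨infoMatrix_posDef_mono one_pos hP hww, fun x => ?_⟩
  have := mul_invNormSq_le one_pos (weight_nonneg z θ₀ c) hP hww x
  rwa [one_mul] at this

/-- Without bad batches the algorithm halts and classifies all arms correctly. -/
lemma correct_of_no_badBatch [Nonempty ι] (hspan : Submodule.span ℝ (Set.range z) = ⊤)
    (hd : 1 ≤ d) {θ₀ : E d} (hθ : ∀ i, inner ℝ (z i) θ₀ ≠ 0) (hδ : 0 < δ) (hδ1 : δ < 1)
    (hω : 0 < ω) (hκ₀ : 0 < κ₀) (hκ : ∀ i, κ₀ ≤ dlink (inner ℝ (z i) θ₀))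
    (hwarm : ¬ BadBatch z θ₀ δ 1 (warmCounts S ω κ₀) (labels y .warmup (warmCounts S ω κ₀)))
    (hmain : ∀ k, ¬ BadBatch z θ₀ δ (k + 1) (roundCounts S ω (k + 1) (state S ω κ₀ y k))
      (labels y (.main (k + 1)) (roundCounts S ω (k + 1) (state S ω κ₀ y k))))
    (hreplay : ∀ T, HaltsAt S ω κ₀ y T → ¬ BadBatch z θ₀ δ 1 (state S ω κ₀ y T).pulled
      (labels y .replay (state S ω κ₀ y T).pulled)) :
    ∃ T, HaltsAt S ω κ₀ y T ∧ EstimatesExist S ω κ₀ y T ∧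
      ∀ i, SignType.sign (inner ℝ (z i) (output S ω κ₀ y T)) =
        SignType.sign (inner ℝ (z i) θ₀) := by
  have hreg0 := (warmCounts_good hspan hd hδ hδ1 hω hκ₀ hκ S).regularBatch hwarm hd hδ hδ1 le_rfl
  have hmle0 : IsMLE z (warmCounts S ω κ₀) (labels y .warmup (warmCounts S ω κ₀))
      (state S ω κ₀ y 0).est := S.mle_spec _ _ hreg0.exists_isMLE
  have hround := fun k => roundCounts_good hspan hd (θ₀ := θ₀) hδ hδ1 hω S
    (Nat.succ_pos k) (state S ω κ₀ y k)
  -- The inductive link: an accurate estimate makes the next batch informative, hence regular, hence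
  -- the next estimate accurate. It holds for all k, even past the halting round, since `state`
  -- continues there.
  have hstep : ∀ k, (∀ i, |inner ℝ (z i) ((state S ω κ₀ y k).est - θ₀)| ≤ 0.107) →
      RegularBatch z θ₀ (roundCounts S ω (k + 1) (state S ω κ₀ y k))
        (labels y (.main (k + 1)) (roundCounts S ω (k + 1) (state S ω κ₀ y k)))
        (radius ι δ (k + 1)) ∧
      IsMLE z (roundCounts S ω (k + 1) (state S ω κ₀ y k))
        (labels y (.main (k + 1)) (roundCounts S ω (k + 1) (state S ω κ₀ y k)))
        (state S ω κ₀ y (k + 1)).est := by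
    intro k hk
    have hreg := (hround k hk).1.regularBatch (hmain k) hd hδ hδ1 (Nat.succ_pos k)
    exact ⟨hreg, S.mle_spec _ _ hreg.exists_isMLE⟩
  have hest : ∀ k i, |inner ℝ (z i) ((state S ω κ₀ y k).est - θ₀)| ≤ 0.107 := by
    intro k
    induction k with
    | zero => exact hreg0.abs_inner_sub_le_const hd hmle0
    | succ k ih => exact (hstep k ih).1.abs_inner_sub_le_const hd (hstep k ih).2
  have hdev : ∀ k, ∀ i ∈ (state S ω κ₀ y k).active,
      |inner ℝ (z i) (state S ω κ₀ y (k + 1)).est - inner ℝ (z i) θ₀| ≤ 0.49 * eps (k + 1) := by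
    intro k i hi
    rw [← inner_sub_right]
    exact (hstep k (hest k)).1.abs_inner_sub_le_of_invNormSq_le hδ hδ1 (Nat.succ_pos k)
      (hstep k (hest k)).2 (eps_pos _).le ((hround k (hest k)).2 i hi)
  -- Once 1.49 ε is below the smallest |zᵀθ₀|, every remaining arm has estimated value above ε and
  -- is removed.
  have hhalt : ∃ T, (state S ω κ₀ y T).active = ∅ := by
    obtain ⟨m, hm⟩ := Finite.exists_min fun i => |inner ℝ (z i) θ₀|
    obtain ⟨k, hk⟩ := exists_pow_lt_of_lt_one
      (show 0 < |inner ℝ (z m) θ₀| / 1.49 from div_pos (abs_pos.2 (hθ m)) (by norm_num))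
      (show (1 / 2 : ℝ) < 1 by norm_num)
    rw [lt_div_iff₀ (by norm_num), ← eps_succ] at hk
    refine ⟨k + 1, Finset.eq_empty_iff_forall_notMem.2 fun i hi => ?_⟩
    rw [state_active_succ] at hi
    have h1 := hdev k i hi.1
    have h2 := abs_sub_abs_le_abs_sub (inner ℝ (z i) θ₀)
      (inner ℝ (z i) (state S ω κ₀ y (k + 1)).est)
    rw [abs_sub_comm] at h2
    linarith [hm i, hi.2]
  classical
  have hT : HaltsAt S ω κ₀ y (Nat.find hhalt) :=
    ⟨Nat.find_spec hhalt, fun k hk => Nat.find_min hhalt hk⟩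
  set T := Nat.find hhalt
  have hT0 : 0 < T := by
    rcases Nat.eq_zero_or_pos T with h | h
    · have := hT.1
      rw [h] at this
      exact absurd this Finset.univ_nonempty.ne_empty
    · exact h
  -- As T > 0, Q contains round 1, whose logarithmic factor is also the one used for the replay.
  have hgood : GoodCounts z θ₀ δ 1 (state S ω κ₀ y T).pulled := by
    have h1 := (hround 0 (hest 0)).1
    obtain ⟨hP, hle⟩ := dataInfo_mono h1.posDef fun i =>
      roundCounts_le_pulled (κ₀ := κ₀) (y := y) hT0 i
    refine ⟨hP, fun i => le_trans (mul_le_mul_of_nonneg_left (hle _) ?_) (h1.leverage i)⟩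
    have h2 := gam_ge (ι := ι) (d := d) hδ hδ1
    have h3 := logTerm_ge (ι := ι) hδ hδ1 le_rfl
    have h4 : (0 : ℝ) ≤ d := Nat.cast_nonneg d
    exact mul_nonneg (by linarith) (by linarith)
  have hreg := hgood.regularBatch (hreplay T hT) hd hδ hδ1 le_rfl
  have hmle : IsMLE z (state S ω κ₀ y T).pulled (labels y .replay (state S ω κ₀ y T).pulled)
      (output S ω κ₀ y T) := S.mle_spec _ _ hreg.exists_isMLE
  refine ⟨T, hT, ⟨hmle0, fun k _ => (hstep k (hest k)).2, hmle⟩, fun i => ?_⟩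
  obtain ⟨k, hkT, hact, hnact⟩ := exists_eliminated hT.1 i
  have helim : eps (k + 1) < |inner ℝ (z i) (state S ω κ₀ y (k + 1)).est| := by
    by_contra hcon
    exact hnact ((state_active_succ k i).2 ⟨hact, not_lt.1 hcon⟩)
  have hdevk := hdev k i hact
  -- Elimination puts the estimate beyond ε while it errs by at most 0.49 ε; the margin 0.51 ε
  -- exceeds the replay error below.
  have hlarge : 0.51 * eps (k + 1) < |inner ℝ (z i) θ₀| := by
    have := abs_sub_abs_le_abs_sub (inner ℝ (z i) (state S ω κ₀ y (k + 1)).est) (inner ℝ (z i) θ₀)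
    linarith
  -- Arm `i` was active in round k + 1, so the width of that round applies; Q includes the round,
  -- and the logarithmic factor at level 1 is no larger.
  have hdevT : |inner ℝ (z i) (output S ω κ₀ y T - θ₀)| ≤ 0.49 * eps (k + 1) := by
    refine hreg.abs_inner_sub_le_of_invNormSq_le hδ hδ1 le_rfl hmle (eps_pos _).le ?_
    obtain ⟨h1, h2⟩ := hround k (hest k)
    have h3 := (dataInfo_mono h1.posDef fun i =>
      roundCounts_le_pulled (κ₀ := κ₀) (y := y) hkT i).2 (z i)
    refine le_trans ?_ (h2 i hact)
    have h4 := logTerm_ge (ι := ι) hδ hδ1 le_rfl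
    refine mul_le_mul (mul_le_mul_of_nonneg_left (logTerm_one_le hδ hδ1 (Nat.succ_pos k))
      (by norm_num)) h3 (invNormSq_nonneg hgood.posDef _) ?_
    have h5 := logTerm_ge (ι := ι) hδ hδ1 (Nat.succ_pos k)
    exact mul_nonneg (by norm_num) (by linarith)
  refine sign_eq_of_abs_sub_lt ?_
  rw [← inner_sub_right]
  have := eps_pos (k + 1)
  linarith

end Runs

/-! ### Adaptivity and the union bound -/

section Probability

open MeasureTheory ProbabilityTheory

variable {d : ℕ} {ι : Type*} {Ω : Type*}

/-- The σ-algebra generated by the labels of the phases in `A`. -/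
abbrev labelAlgebra (Y : Ω → Phase → ι → ℕ → Bool) (A : Set Phase) : MeasurableSpace Ω :=
  ⨆ q ∈ {q : Phase × ι × ℕ | q.1 ∈ A}, MeasurableSpace.comap (fun a => Y a q.1 q.2.1 q.2.2) ⊤

lemma labelAlgebra_mono (Y : Ω → Phase → ι → ℕ → Bool) {A B : Set Phase} (h : A ⊆ B) :
    labelAlgebra Y A ≤ labelAlgebra Y B :=
  biSup_mono fun _ hq => h hq

lemma measurableSet_label (Y : Ω → Phase → ι → ℕ → Bool) {A : Set Phase} {p : Phase} (hp : p ∈ A)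
    (i : ι) (j : ℕ) (b : Bool) : MeasurableSet[labelAlgebra Y A] {a | Y a p i j = b} := by
  have hle : MeasurableSpace.comap (fun a => Y a p i j) ⊤ ≤ labelAlgebra Y A :=
    le_iSup₂_of_le (f := fun (q : Phase × ι × ℕ) (_ : q ∈ {q : Phase × ι × ℕ | q.1 ∈ A}) =>
      MeasurableSpace.comap (fun a => Y a q.1 q.2.1 q.2.2) ⊤) (p, i, j) hp le_rfl
  exact hle _ ⟨{b}, trivial, rfl⟩

lemma measurableSet_labels_eq [Fintype ι] (Y : Ω → Phase → ι → ℕ → Bool) {A : Set Phase} {p : Phase}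
    (hp : p ∈ A) (c : ι → ℕ) (y : (i : ι) → Fin (c i) → Bool) :
    MeasurableSet[labelAlgebra Y A] {a | labels (Y a) p c = y} := by
  have : {a | labels (Y a) p c = y} = ⋂ i, ⋂ j : Fin (c i), {a | Y a p i j = y i j} := by
    ext a; simp [labels, funext_iff]
  rw [this]
  exact MeasurableSet.iInter fun i => MeasurableSet.iInter fun j => measurableSet_label Y hp i j _

/-- There are only finitely many label vectors for given counts, so `B` may be arbitrary. -/
lemma measurableSet_labels [Fintype ι] (Y : Ω → Phase → ι → ℕ → Bool) {A : Set Phase} {p : Phase}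
    (hp : p ∈ A) (c : ι → ℕ) (B : ((i : ι) → Fin (c i) → Bool) → Prop) :
    MeasurableSet[labelAlgebra Y A] {a | B (labels (Y a) p c)} := by
  have : {a | B (labels (Y a) p c)} = ⋃ y ∈ {y | B y}, {a | labels (Y a) p c = y} := by
    ext a; simp
  rw [this]
  exact MeasurableSet.biUnion (Set.to_countable _) fun y _ => measurableSet_labels_eq Y hp c y

/-- The phases that precede round `k + 1`. -/
def pastPhases (k : ℕ) : Set Phase := {p | p = .warmup ∨ ∃ l ≤ k, p = .main l}

lemma pastPhases_mono {k k' : ℕ} (h : k ≤ k') : pastPhases k ⊆ pastPhases k' := by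
  rintro p (rfl | ⟨l, hl, rfl⟩)
  · exact Or.inl rfl
  · exact Or.inr ⟨l, hl.trans h, rfl⟩

/-- The state after `k` rounds is a function of the labels seen so far. -/
lemma measurableSet_state [Fintype ι] {z : ι → E d} {δ : ℝ} (S : Solver z δ) (ω κ₀ : ℝ)
    (Y : Ω → Phase → ι → ℕ → Bool) (k : ℕ) (A : State d ι → Prop) :
    MeasurableSet[labelAlgebra Y (pastPhases k)] {a | A (state S ω κ₀ (Y a) k)} := by
  classical
  induction k generalizing A with
  | zero =>
    exact measurableSet_labels Y (Or.inl rfl) (warmCounts S ω κ₀)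
      fun y => A ⟨S.mle (warmCounts S ω κ₀) y, Finset.univ, 0⟩
  | succ k ih =>
    let next : State d ι → (c : ι → ℕ) → ((i : ι) → Fin (c i) → Bool) → State d ι := fun s c y =>
      ⟨S.mle c y, s.active.filter (fun i => ¬ eps (k + 1) < |inner ℝ (z i) (S.mle c y)|),
        s.pulled + c⟩
    have hnext : ∀ a, state S ω κ₀ (Y a) (k + 1) = next (state S ω κ₀ (Y a) k)
        (roundCounts S ω (k + 1) (state S ω κ₀ (Y a) k))
        (labels (Y a) (.main (k + 1)) (roundCounts S ω (k + 1) (state S ω κ₀ (Y a) k))) := by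
      intro a
      simp only [next, state]
    -- Split over the countably many counts and labels; with these fixed, the next state is a
    -- function of the current one. Inducting over arbitrary predicates `A` removes any need for
    -- measurability of the solver.
    have : {a | A (state S ω κ₀ (Y a) (k + 1))} = ⋃ c : ι → ℕ, ⋃ y : (i : ι) → Fin (c i) → Bool,
        {a | roundCounts S ω (k + 1) (state S ω κ₀ (Y a) k) = c ∧
          A (next (state S ω κ₀ (Y a) k) c y)} ∩ {a | labels (Y a) (.main (k + 1)) c = y} := by
      ext a
      simp only [Set.mem_ofPred_eq, Set.mem_iUnion, Set.mem_inter_iff, hnext]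
      constructor
      · intro h
        exact ⟨_, _, ⟨rfl, h⟩, rfl⟩
      · rintro ⟨c, y, ⟨rfl, h⟩, rfl⟩
        exact h
    rw [this]
    refine MeasurableSet.iUnion fun c => MeasurableSet.iUnion fun y => MeasurableSet.inter ?_ ?_
    · exact labelAlgebra_mono Y (pastPhases_mono k.le_succ) _
        (ih fun s => roundCounts S ω (k + 1) s = c ∧ A (next s c y))
    · exact measurableSet_labels_eq Y (Or.inr ⟨k + 1, le_rfl, rfl⟩) c y

variable {mΩ : MeasurableSpace Ω}

lemma labelAlgebra_le {Y : Ω → Phase → ι → ℕ → Bool}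
    (hYm : ∀ p i j, Measurable (fun a => Y a p i j)) (A : Set Phase) :
    labelAlgebra Y A ≤ mΩ :=
  iSup₂_le fun q _ => (hYm q.1 q.2.1 q.2.2).comap_le

lemma indep_labelAlgebra {P : Measure Ω} {Y : Ω → Phase → ι → ℕ → Bool}
    (hYm : ∀ p i j, Measurable (fun a => Y a p i j))
    (hYindep : iIndepFun (fun (q : Phase × ι × ℕ) (a : Ω) => Y a q.1 q.2.1 q.2.2) P)
    {A B : Set Phase} (hAB : Disjoint A B) : Indep (labelAlgebra Y A) (labelAlgebra Y B) P := by
  refine indep_iSup_of_disjoint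
    (m := fun q : Phase × ι × ℕ => MeasurableSpace.comap (fun a => Y a q.1 q.2.1 q.2.2) ⊤)
    (fun q => (hYm q.1 q.2.1 q.2.2).comap_le) hYindep ?_
  exact Set.disjoint_left.2 fun q hA hB => Set.disjoint_left.1 hAB hA hB

variable {P : Measure Ω} [IsProbabilityMeasure P]

/-- An event chosen by an independent countably valued index is as unlikely as each single one. -/
lemma measure_mem_random_le {C : Type*} [Countable C] {m₁ m₂ : MeasurableSpace Ω}
    (hm₁ : m₁ ≤ mΩ) (hind : Indep m₁ m₂ P) {X : Ω → C}
    (hX : ∀ c, MeasurableSet[m₁] {a | X a = c}) {B : C → Set Ω} (hB : ∀ c, MeasurableSet[m₂] (B c))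
    {η : ℝ} (hη : ∀ c, P.real (B c) ≤ η) : P {a | a ∈ B (X a)} ≤ ENNReal.ofReal η := by
  have hset : {a | a ∈ B (X a)} = ⋃ c, {a | X a = c} ∩ B c := by
    ext a; simp
  have hone : ∑' c, P {a | X a = c} = 1 := by
    rw [← measure_iUnion ?_ fun c => hm₁ _ (hX c)]
    · have : ⋃ c, {a | X a = c} = Set.univ := by ext a; simp
      rw [this, measure_univ]
    · intro c c' hcc
      exact Set.disjoint_left.2 fun a h h' => hcc (h.symm.trans h')
  rw [hset]
  calc P (⋃ c, {a | X a = c} ∩ B c) ≤ ∑' c, P ({a | X a = c} ∩ B c) := measure_iUnion_le _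
    _ ≤ ∑' c, P {a | X a = c} * ENNReal.ofReal η := by
        refine ENNReal.tsum_le_tsum fun c => ?_
        rw [(Indep_iff m₁ m₂ P).1 hind _ _ (hX c) (hB c)]
        gcongr
        rw [← ofReal_measureReal]
        exact ENNReal.ofReal_le_ofReal (hη c)
    _ = ENNReal.ofReal η := by rw [ENNReal.tsum_mul_right, hone, one_mul]

variable [Fintype ι] [Nonempty ι] {z : ι → E d} {θ₀ : E d} {δ : ℝ}

/-- Probability of a bad batch with predetermined numbers of pulls. -/
lemma badBatch_prob_le {Y : Ω → Phase → ι → ℕ → Bool}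
    (hYm : ∀ p i j, Measurable (fun a => Y a p i j))
    (hYindep : iIndepFun (fun (q : Phase × ι × ℕ) (a : Ω) => Y a q.1 q.2.1 q.2.2) P)
    (hYlaw : ∀ p i j, P.real {a | Y a p i j = true} = Real.sigmoid (inner ℝ (z i) θ₀))
    (hd : 1 ≤ d) (hz : ∀ i, z i ≠ 0) (hδ : 0 < δ) (hδ1 : δ < 1) {l : ℕ} (hl : 1 ≤ l)
    (p : Phase) (c : ι → ℕ) :
    P.real {a | BadBatch z θ₀ δ l c (labels (Y a) p c)} ≤ 2 * δ / 9 * (1 / (l : ℝ) ^ 2) := by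
  have hl' : (1 : ℝ) ≤ l := by exact_mod_cast hl
  have hK : (1 : ℝ) ≤ Fintype.card ι := by exact_mod_cast Fintype.card_pos
  -- For uninformative counts the event is empty, so the bound holds for every `c`, as conditioning
  -- on random counts requires.
  by_cases hgood : GoodCounts z θ₀ δ l c
  swap
  · have : {a | BadBatch z θ₀ δ l c (labels (Y a) p c)} = ∅ := by
      ext a; simp [BadBatch, hgood]
    rw [this, measureReal_empty]
    positivity
  have hset : {a | BadBatch z θ₀ δ l c (labels (Y a) p c)} ⊆ {a | ∃ k, radius ι δ l *
      √(invNormSq (dataInfo z θ₀ c) (z k)) < |linError z θ₀ c (labels (Y a) p c) k|} :=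
    fun a ha => ha.2
  have hb := radius_nonneg ι δ l
  have hlev : ∀ i, √(invNormSq (dataInfo z θ₀ c) (z i)) * radius ι δ l ≤ 0.1 := by
    intro i
    refine le_trans ?_ (hgood.leverage_radius hd hδ hδ1 hl i)
    have h3 : (1 : ℝ) ≤ √d := Real.one_le_sqrt.2 (by exact_mod_cast hd)
    exact mul_le_mul_of_nonneg_left (by nlinarith) (Real.sqrt_nonneg _)
  have htail := linError_tail hYm hYindep hYlaw p c hb hz hgood.posDef hlev
  refine (measureReal_mono hset).trans (htail.trans ?_)
  set D := 2 * (l : ℝ) ^ 2 * Fintype.card ι * (2 + Fintype.card ι) / δ with hD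
  have hD6 : 6 ≤ D := six_le_logTerm_arg hδ hδ1 hl
  -- 0.47 · 2.75 > 1.29, and the surplus over 1 pays for the factor 1.5, as log 1.5 ≤ (log 6)/4.
  have hexp : Real.exp (-(0.47 * radius ι δ l ^ 2)) ≤ (1.5 * D)⁻¹ := by
    rw [radius_sq hδ hδ1 hl, ← Real.exp_log (show 0 < 1.5 * D by linarith), ← Real.exp_neg,
      Real.exp_le_exp, neg_le_neg_iff, Real.log_mul (by norm_num) (by linarith)]
    have h1 : 4 * Real.log 1.5 ≤ Real.log 6 := by
      rw [← Nat.cast_ofNat, ← Real.log_pow]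
      exact Real.log_le_log (by norm_num) (by norm_num)
    have h2 := log_six_le_logTerm (ι := ι) hδ hδ1 hl
    have h3 : Real.log D = logTerm ι δ l := rfl
    have h4 := log_six_ge
    linarith
  -- In D one factor K absorbs the union over arms, l² makes the rounds summable, and 2 + K ≥ 3
  -- yields 2/9.
  calc 2 * Fintype.card ι * Real.exp (-(0.47 * radius ι δ l ^ 2))
      ≤ 2 * Fintype.card ι * (1.5 * D)⁻¹ := mul_le_mul_of_nonneg_left hexp (by positivity)
    _ = 2 * δ / (3 * (2 + Fintype.card ι)) * (1 / (l : ℝ) ^ 2) := by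
        rw [hD]; field_simp; ring
    _ ≤ 2 * δ / 9 * (1 / (l : ℝ) ^ 2) := by
        refine mul_le_mul_of_nonneg_right ?_ (by positivity)
        exact div_le_div_of_nonneg_left (by positivity) (by norm_num) (by linarith)

lemma hasSum_inv_succ_sq : HasSum (fun k : ℕ => 1 / ((k : ℝ) + 1) ^ 2) (Real.pi ^ 2 / 6) := by
  have h := (hasSum_nat_add_iff' 1).2 hasSum_zeta_two
  simpa using h

section Solver

variable {ι : Type*} [Fintype ι] {z : ι → E d} {δ : ℝ} (S : Solver z δ) (ω κ₀ : ℝ)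

lemma HaltsAt.unique {S : Solver z δ} {ω κ₀ : ℝ} {y : Phase → ι → ℕ → Bool} {T T' : ℕ}
    (h : HaltsAt S ω κ₀ y T) (h' : HaltsAt S ω κ₀ y T') : T = T' := by
  rcases lt_trichotomy T T' with hlt | heq | hlt
  · exact absurd h.1 (h'.2 T hlt)
  · exact heq
  · exact absurd h'.1 (h.2 T' hlt)

open Classical in
/-- The numbers of pulls of the arms in the replay (zero if the loop does not end). -/
def replayCounts (y : Phase → ι → ℕ → Bool) : ι → ℕ :=
  if h : ∃ T, HaltsAt S ω κ₀ y T then (state S ω κ₀ y h.choose).pulled else 0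

variable {S ω κ₀}

lemma HaltsAt.replayCounts_eq {y : Phase → ι → ℕ → Bool} {T : ℕ} (h : HaltsAt S ω κ₀ y T) :
    replayCounts S ω κ₀ y = (state S ω κ₀ y T).pulled := by
  have hex : ∃ T, HaltsAt S ω κ₀ y T := ⟨T, h⟩
  rw [replayCounts, dif_pos hex, hex.choose_spec.unique h]

lemma replayCounts_eq_zero {y : Phase → ι → ℕ → Bool} (h : ¬ ∃ T, HaltsAt S ω κ₀ y T) :
    replayCounts S ω κ₀ y = 0 := dif_neg h

variable (S ω κ₀)

/-- Halting and Q are determined by the warm-up and main phases, so the replay labels are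
independent of the multiset they are drawn for. The value 0 on non-halting tables makes the counts
defined everywhere. -/
lemma measurableSet_replayCounts (Y : Ω → Phase → ι → ℕ → Bool) (c : ι → ℕ) :
    MeasurableSet[labelAlgebra Y {p | p ≠ .replay}] {a | replayCounts S ω κ₀ (Y a) = c} := by
  have hpast : ∀ k, pastPhases k ⊆ {p | p ≠ .replay} := by
    rintro k p (rfl | ⟨l, -, rfl⟩) h <;> exact Phase.noConfusion h
  have hstate : ∀ k (A : State d ι → Prop),
      MeasurableSet[labelAlgebra Y {p | p ≠ .replay}] {a | A (state S ω κ₀ (Y a) k)} :=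
    fun k A => labelAlgebra_mono Y (hpast k) _ (measurableSet_state S ω κ₀ Y k A)
  have hhalts : ∀ T, MeasurableSet[labelAlgebra Y {p | p ≠ .replay}]
      {a | HaltsAt S ω κ₀ (Y a) T} := by
    intro T
    have : {a | HaltsAt S ω κ₀ (Y a) T} = {a | (state S ω κ₀ (Y a) T).active = ∅} ∩
        ⋂ k ∈ {k | k < T}, {a | (state S ω κ₀ (Y a) k).active ≠ ∅} := by
      ext a; simp [HaltsAt]
    rw [this]
    exact (hstate T fun s => s.active = ∅).inter
      (MeasurableSet.biInter (Set.to_countable _) fun k _ => hstate k fun s => s.active ≠ ∅)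
  have : {a | replayCounts S ω κ₀ (Y a) = c} =
      (⋃ T, {a | HaltsAt S ω κ₀ (Y a) T} ∩ {a | (state S ω κ₀ (Y a) T).pulled = c}) ∪
      ((⋃ T, {a | HaltsAt S ω κ₀ (Y a) T})ᶜ ∩ {_a | (0 : ι → ℕ) = c}) := by
    ext a
    simp only [Set.mem_union, Set.mem_iUnion, Set.mem_inter_iff, Set.mem_ofPred_eq,
      Set.mem_compl_iff]
    by_cases hex : ∃ T, HaltsAt S ω κ₀ (Y a) T
    · obtain ⟨T, hT⟩ := hex
      rw [hT.replayCounts_eq]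
      constructor
      · exact fun h => Or.inl ⟨T, hT, h⟩
      · rintro (⟨T', hT', h⟩ | ⟨h, -⟩)
        · rw [hT.unique hT', h]
        · exact absurd ⟨T, hT⟩ h
    · rw [replayCounts_eq_zero hex]
      constructor
      · exact fun h => Or.inr ⟨hex, h⟩
      · rintro (⟨T, hT, -⟩ | ⟨-, h⟩)
        · exact absurd ⟨T, hT⟩ hex
        · exact h
  rw [this]
  exact MeasurableSet.union (MeasurableSet.iUnion fun T => (hhalts T).inter
    (hstate T fun s => s.pulled = c)) (MeasurableSet.inter
      (MeasurableSet.iUnion fun T => hhalts T).compl (MeasurableSet.const _))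

end Solver

section UnionBound

variable {Y : Ω → Phase → ι → ℕ → Bool}

/-- The counts are determined by `pastPhases k`, which excludes the phase supplying the labels, so
the bound for fixed counts carries over. -/
lemma badBatch_round_prob_le (hd : 1 ≤ d) (hz : ∀ i, z i ≠ 0) (hδ : 0 < δ) (hδ1 : δ < 1)
    (ω κ₀ : ℝ) (S : Solver z δ) (hYm : ∀ p i j, Measurable (fun a => Y a p i j))
    (hYindep : iIndepFun (fun (q : Phase × ι × ℕ) (a : Ω) => Y a q.1 q.2.1 q.2.2) P)
    (hYlaw : ∀ p i j, P.real {a | Y a p i j = true} = Real.sigmoid (inner ℝ (z i) θ₀)) (k : ℕ) :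
    P {a | BadBatch z θ₀ δ (k + 1) (roundCounts S ω (k + 1) (state S ω κ₀ (Y a) k))
      (labels (Y a) (.main (k + 1)) (roundCounts S ω (k + 1) (state S ω κ₀ (Y a) k)))} ≤
      ENNReal.ofReal (2 * δ / 9 * (1 / ((k : ℝ) + 1) ^ 2)) := by
  have hdisj : Disjoint (pastPhases k) {.main (k + 1)} := by
    rw [Set.disjoint_singleton_right]
    rintro (h | ⟨l, hl, h⟩)
    · exact Phase.noConfusion h
    · have := Phase.main.inj h
      omega
  have hη : ∀ c, P.real {a | BadBatch z θ₀ δ (k + 1) c (labels (Y a) (.main (k + 1)) c)} ≤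
      2 * δ / 9 * (1 / ((k : ℝ) + 1) ^ 2) := fun c => by
    have := badBatch_prob_le (z := z) (θ₀ := θ₀) hYm hYindep hYlaw hd hz hδ hδ1
      (Nat.succ_pos k) (.main (k + 1)) c
    rwa [Nat.succ_eq_add_one, Nat.cast_add, Nat.cast_one] at this
  exact measure_mem_random_le (labelAlgebra_le hYm (pastPhases k))
    (indep_labelAlgebra hYm hYindep hdisj)
    (X := fun a => roundCounts S ω (k + 1) (state S ω κ₀ (Y a) k))
    (fun c => measurableSet_state S ω κ₀ Y k fun s => roundCounts S ω (k + 1) s = c)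
    (fun c => measurableSet_labels Y (Set.mem_singleton _) c
      fun y => BadBatch z θ₀ δ (k + 1) c y) hη

lemma badBatch_replay_prob_le (hd : 1 ≤ d) (hz : ∀ i, z i ≠ 0) (hδ : 0 < δ) (hδ1 : δ < 1)
    (ω κ₀ : ℝ) (S : Solver z δ) (hYm : ∀ p i j, Measurable (fun a => Y a p i j))
    (hYindep : iIndepFun (fun (q : Phase × ι × ℕ) (a : Ω) => Y a q.1 q.2.1 q.2.2) P)
    (hYlaw : ∀ p i j, P.real {a | Y a p i j = true} = Real.sigmoid (inner ℝ (z i) θ₀)) :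
    P {a | BadBatch z θ₀ δ 1 (replayCounts S ω κ₀ (Y a))
      (labels (Y a) .replay (replayCounts S ω κ₀ (Y a)))} ≤ ENNReal.ofReal (2 * δ / 9) := by
  have hdisj : Disjoint {p : Phase | p ≠ .replay} {.replay} := by
    rw [Set.disjoint_singleton_right]
    exact fun h => h rfl
  have hη : ∀ c, P.real {a | BadBatch z θ₀ δ 1 c (labels (Y a) .replay c)} ≤ 2 * δ / 9 :=
    fun c => by
      have := badBatch_prob_le (z := z) (θ₀ := θ₀) hYm hYindep hYlaw hd hz hδ hδ1 le_rfl .replay c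
      simpa using this
  exact measure_mem_random_le (labelAlgebra_le hYm _) (indep_labelAlgebra hYm hYindep hdisj)
    (X := fun a => replayCounts S ω κ₀ (Y a)) (measurableSet_replayCounts S ω κ₀ Y)
    (fun c => measurableSet_labels Y (Set.mem_singleton _) c fun y => BadBatch z θ₀ δ 1 c y) hη

/-- Bad batches occur in a run with probability at most `δ`. -/
lemma exists_badBatch_prob_le (hd : 1 ≤ d) (hz : ∀ i, z i ≠ 0) (hδ : 0 < δ) (hδ1 : δ < 1)
    (ω κ₀ : ℝ) (S : Solver z δ) (hYm : ∀ p i j, Measurable (fun a => Y a p i j))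
    (hYindep : iIndepFun (fun (q : Phase × ι × ℕ) (a : Ω) => Y a q.1 q.2.1 q.2.2) P)
    (hYlaw : ∀ p i j, P.real {a | Y a p i j = true} = Real.sigmoid (inner ℝ (z i) θ₀)) :
    P ({a | BadBatch z θ₀ δ 1 (warmCounts S ω κ₀) (labels (Y a) .warmup (warmCounts S ω κ₀))} ∪
      ({a | ∃ k, BadBatch z θ₀ δ (k + 1) (roundCounts S ω (k + 1) (state S ω κ₀ (Y a) k))
        (labels (Y a) (.main (k + 1)) (roundCounts S ω (k + 1) (state S ω κ₀ (Y a) k)))} ∪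
      {a | BadBatch z θ₀ δ 1 (replayCounts S ω κ₀ (Y a))
        (labels (Y a) .replay (replayCounts S ω κ₀ (Y a)))})) ≤ ENNReal.ofReal δ := by
  have hwarm : P {a | BadBatch z θ₀ δ 1 (warmCounts S ω κ₀)
      (labels (Y a) .warmup (warmCounts S ω κ₀))} ≤ ENNReal.ofReal (2 * δ / 9) := by
    rw [← ofReal_measureReal]
    refine ENNReal.ofReal_le_ofReal ?_
    have := badBatch_prob_le (z := z) (θ₀ := θ₀) hYm hYindep hYlaw hd hz hδ hδ1 le_rfl .warmup
      (warmCounts S ω κ₀)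
    simpa using this
  have hrounds : P {a | ∃ k, BadBatch z θ₀ δ (k + 1)
      (roundCounts S ω (k + 1) (state S ω κ₀ (Y a) k))
      (labels (Y a) (.main (k + 1)) (roundCounts S ω (k + 1) (state S ω κ₀ (Y a) k)))} ≤
      ENNReal.ofReal (4 * δ / 9) := by
    have hs := hasSum_inv_succ_sq.mul_left (2 * δ / 9)
    rw [Set.ofPred_exists]
    refine (measure_iUnion_le _).trans ((ENNReal.tsum_le_tsum fun k =>
      badBatch_round_prob_le hd hz hδ hδ1 ω κ₀ S hYm hYindep hYlaw k).trans ?_)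
    rw [← ENNReal.ofReal_tsum_of_nonneg (fun k => by positivity) hs.summable, hs.tsum_eq]
    refine ENNReal.ofReal_le_ofReal ?_
    -- Since π²/6 ≤ 2, all rounds together cost at most 4δ/9; the three shares add up to 8δ/9.
    have h1 : Real.pi ^ 2 ≤ 12 := by nlinarith [Real.pi_pos, Real.pi_lt_d2]
    nlinarith
  refine ((measure_union_le _ _).trans (add_le_add hwarm ((measure_union_le _ _).trans
    (add_le_add hrounds (badBatch_replay_prob_le hd hz hδ hδ1 ω κ₀ S hYm hYindep hYlaw))))).trans ?_
  rw [← ENNReal.ofReal_add (by positivity) (by positivity),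
    ← ENNReal.ofReal_add (by positivity) (by positivity)]
  exact ENNReal.ofReal_le_ofReal (by linarith)

end UnionBound

end Probability

end ActivePref

end

/-! ### Conclusion: the failure event lies in the union of the bad batches. -/

theorem theorem3 {d : ℕ} {ι : Type*} [Fintype ι] [Nonempty ι]
    (z : ι → ActivePref.E d) (hz : ∀ i, ‖z i‖ ≤ 1)
    (hspan : Submodule.span ℝ (Set.range z) = ⊤)
    (θstar : ActivePref.E d) (hθ : ∀ i, inner ℝ (z i) θstar ≠ 0)
    (δ ω κ₀ : ℝ) (hδ : 0 < δ) (hω : 0 < ω) (hκ₀ : 0 < κ₀)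
    (hκ : ∀ i, κ₀ ≤ ActivePref.dlink (inner ℝ (z i) θstar))
    (S : ActivePref.Solver z δ)
    {Ω : Type*} [MeasurableSpace Ω] (P : MeasureTheory.Measure Ω)
    [MeasureTheory.IsProbabilityMeasure P]
    (Y : Ω → ActivePref.Phase → ι → ℕ → Bool)
    (hYm : ∀ p i j, Measurable (fun a => Y a p i j))
    (hYindep : ProbabilityTheory.iIndepFun
      (fun (q : ActivePref.Phase × ι × ℕ) (a : Ω) => Y a q.1 q.2.1 q.2.2) P)
    (hYlaw : ∀ p i j,
      P.real {a | Y a p i j = true} = Real.sigmoid (inner ℝ (z i) θstar)) :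
    1 - δ ≤ P.real {a | ∃ T, ActivePref.HaltsAt S ω κ₀ (Y a) T ∧
      ActivePref.EstimatesExist S ω κ₀ (Y a) T ∧
      ∀ i, SignType.sign (inner ℝ (z i) (ActivePref.output S ω κ₀ (Y a) T)) =
        SignType.sign (inner ℝ (z i) θstar)} := by
  rcases le_or_gt 1 δ with hδ1 | hδ1
  · exact (sub_nonpos.2 hδ1).trans MeasureTheory.measureReal_nonneg
  have hz0 : ∀ i, z i ≠ 0 := fun i h => hθ i (by rw [h, inner_zero_left])
  -- In dimension 0 every arm would be the zero vector, contradicting zᵀθ* ≠ 0.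
  have hd : 1 ≤ d := by
    rcases Nat.eq_zero_or_pos d with rfl | h
    · exact absurd (Subsingleton.elim _ _) (hz0 (Classical.arbitrary ι))
    · exact h
  have hbad := ActivePref.exists_badBatch_prob_le (θ₀ := θstar) hd hz0 hδ hδ1 ω κ₀ S hYm hYindep
    hYlaw
  set good := {a | ∃ T, ActivePref.HaltsAt S ω κ₀ (Y a) T ∧
      ActivePref.EstimatesExist S ω κ₀ (Y a) T ∧
      ∀ i, SignType.sign (inner ℝ (z i) (ActivePref.output S ω κ₀ (Y a) T)) =
        SignType.sign (inner ℝ (z i) θstar)}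
  have hcompl : P.real goodᶜ ≤ δ := by
    refine ENNReal.toReal_le_of_le_ofReal hδ.le (le_trans (MeasureTheory.measure_mono ?_) hbad)
    intro a ha
    by_contra hcon
    simp only [Set.mem_union, not_or, Set.mem_ofPred_eq, not_exists] at hcon
    refine ha (ActivePref.correct_of_no_badBatch hspan hd hθ hδ hδ1 hω hκ₀ hκ hcon.1 hcon.2.1 ?_)
    intro T hT
    rw [← hT.replayCounts_eq]
    exact hcon.2.2
  -- Subadditivity replaces the complement rule, so `good` need not be measurable.
  have hone : 1 ≤ P.real good + P.real goodᶜ := by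
    have := MeasureTheory.measureReal_union_le (μ := P) good goodᶜ
    rwa [Set.union_compl_self, MeasureTheory.probReal_univ] at this
  linarith
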